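/- Let $\delta>0$ and let $0<\varepsilon_-<\varepsilon_+<\infty$. (1) For every real constant $\lambda_0$ there is exactly one positive function $u_s\in C^2(\mathbb R)$ with $$2\delta\,u_s u_s''+2\delta\,(u_s')^2+(\xi+\lambda_0)\,u_s'=0\ \text{ on }\mathbb R,\qquad \lim_{\xi\to-\infty}u_s(\xi)=\varepsilon_-,\qquad \lim_{\xi\to+\infty}u_s(\xi)=\varepsilon_+ .$$ (2) This $u_s$ is strictly increasing on $\mathbb R$. For every $T>0$ the self-similar function $$w(z,\theta)=u_s\!\left(\frac{z-z_c(\theta)}{\sqrt{\theta}}\right),\qquad z_c(\theta)=\lambda_0\sqrt{\theta},$$ is the unique positive bounded classical solution on $\mathbb R\times(0,T)$ of the porous medium equation $$\frac{\partial w}{\partial\theta}=\frac{\partial}{\partial z}\left[\delta\,w\,\frac{\partial w}{\partial z}\right]$$ with the step initial data $w(z,0)=\varepsilon_-$ for $z<0$ and $w(z,0)=\varepsilon_+$ for $z>0$. Here "classical" means that $w$, $w_\theta$, $w_z$, $w_{zz}$ exist and are continuous on $\mathbb R\times(0,T)$, and the initial data are attained as the limit $\theta\to0^+$ at each $z\ne0$.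 (3) There is exactly one value of the constant $\lambda_0$, that is, exactly one choice of the central line $z=z_c(\theta)$ (depending on $\delta,\varepsilon_\pm$), for which $u_s$ is convex for $\xi<0$ and concave for $\xi>0$. -/

import Mathlib

open Set Filter Topology

/-- `u` is a positive (twice continuously differentiable) solution on the whole line of
`2δ u u'' + 2δ (u')² + (ξ + lam) u' = 0` with `u(-∞) = εm` and `u(+∞) = εp`. -/
structure IsProfile (δ lam εm εp : ℝ) (u : ℝ → ℝ) : Prop where
  contDiff : ContDiff ℝ 2 u
  pos : ∀ ξ, 0 < u ξ
  ode : ∀ ξ, 2 * δ * (u ξ * deriv (deriv u) ξ) + 2 * δ * (deriv u ξ) ^ 2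
    + (ξ + lam) * deriv u ξ = 0
  tendsto_atBot : Tendsto u atBot (𝓝 εm)
  tendsto_atTop : Tendsto u atTop (𝓝 εp)

/-- The function `(z, θ) ↦ u ((z - z_c(θ)) / √θ)` with the central line `z_c(θ) = lam √θ`. -/
noncomputable def selfSimilar (lam : ℝ) (u : ℝ → ℝ) (z θ : ℝ) : ℝ :=
  u ((z - lam * √θ) / √θ)

/-- `w` is a positive bounded classical solution on `ℝ × (0, T)` of the Cauchy problem for the
porous medium equation `∂w/∂θ = ∂/∂z (δ w ∂w/∂z)` whose initial value is the step function
equal to `εm` on the left and to `εp` on the right of the origin. The initial values are attained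
at every point except the jump. -/
structure IsPMESolution (δ εm εp T : ℝ) (w : ℝ → ℝ → ℝ) : Prop where
  pos : ∀ z, ∀ θ ∈ Ioo 0 T, 0 < w z θ
  bounded : ∃ M : ℝ, ∀ z, ∀ θ ∈ Ioo 0 T, w z θ ≤ M
  contDiff_space : ∀ θ ∈ Ioo 0 T, ContDiff ℝ 2 (fun y => w y θ)
  differentiable_time : ∀ z, ∀ θ ∈ Ioo 0 T, DifferentiableAt ℝ (fun s => w z s) θ
  continuousOn : ContinuousOn (fun p : ℝ × ℝ => w p.1 p.2) (univ ×ˢ Ioo 0 T)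
  continuousOn_time :
    ContinuousOn (fun p : ℝ × ℝ => deriv (fun s => w p.1 s) p.2) (univ ×ˢ Ioo 0 T)
  continuousOn_space :
    ContinuousOn (fun p : ℝ × ℝ => deriv (fun y => w y p.2) p.1) (univ ×ˢ Ioo 0 T)
  continuousOn_space_two :
    ContinuousOn (fun p : ℝ × ℝ => deriv (deriv (fun y => w y p.2)) p.1) (univ ×ˢ Ioo 0 T)
  pde : ∀ z, ∀ θ ∈ Ioo 0 T,
    deriv (fun s => w z s) θ = deriv (fun y => δ * w y θ * deriv (fun x => w x θ) y) z
  initial_neg : ∀ z < 0, Tendsto (fun θ => w z θ) (𝓝[>] 0) (𝓝 εm)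
  initial_pos : ∀ z > 0, Tendsto (fun θ => w z θ) (𝓝[>] 0) (𝓝 εp)

/-!
The proof rests on three arguments.

*Uniqueness for the porous medium equation.* The difference `d` of two solutions `w`, `v` solves the
linear equation `d_θ = (a d)_zz` with the bounded positive coefficient `a = δ (w + v) / 2`. Its time
integral `E(z, θ) = ∫₀^θ a d` then satisfies `E_zz = d`, since the initial value of `d` vanishes
away from the origin, and `E_θ = a d = a E_zz`. The function `E` is bounded and vanishes at `θ = 0`,
so the maximum principle with the barrier `η (z² + K θ)` gives `E = 0`, hence `d = 0`
(`IsLinearSolution.integral_le_barrier`, `IsPMESolution.unique`). No lower bound on `w` and no decay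
in space are needed. The second derivative of `E` is tested against tent functions, so that `E` need
not be differentiated. Since a profile is the value at `θ = 1` of its self-similar solution,
uniqueness of the profile follows (`IsProfile.unique`).

*Existence of the profile.* A translation of `ξ` changes `lam`, so `lam = 0` suffices. The equation
reads `δ (u²)'' = -ξ u'`, which makes `(u²)'` a multiple `q` of the weight
`G u = exp (-∫₀^ξ s / (2 δ u(s)) ds)`; with the prescribed limit `m` at `-∞` it becomes the
fixed-point problem `u² = m² + q ∫_{-∞}^ξ G u`. The weight is increasing in `u` on both half-lines,
so monotone iteration from the constant `m` yields a least fixed point, which is also monotone in `q`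
(`exists_isFixedProfile_le`). For a given `q` the fixed point is unique (`IsFixedProfile.eq_of_le`):
for `u ≤ v` the difference of the expressions `δ (u²)' + ξ u`, whose derivatives are `u` and `v`, is
monotone and vanishes at `-∞` and at `0`, which settles `ξ ≤ 0`, and Gronwall's inequality settles
`ξ ≥ 0`. Uniqueness makes the limit at `+∞` continuous in `q`, and it takes every value above `m`
(`exists_isFixedProfile_limit`).

*The inflection point.* For the profile with `lam = 0`, the function `F = 2 δ u u' + ξ u` has
derivative `u > 0`, and `2 δ u² u'' = -u' F`. Hence `u''` changes sign exactly once, from positive to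
negative, at the zero of `F` (`IsProfile.exists_inflection`), and the translation by `lam` moves this
point to the origin for exactly one `lam`.
-/

/-! ### Linear equations in double divergence form -/

/-- `d` is a bounded classical solution on `ℝ × (0, T)` of the linear equation
`∂d/∂θ = ∂²(a d)/∂z²` with a bounded positive coefficient `a`, whose initial value is zero at every
point except the origin. The functions `g` and `d'` are `∂(a d)/∂z` and `∂d/∂θ`. -/
structure IsLinearSolution (T : ℝ) (a d g d' : ℝ → ℝ → ℝ) : Prop where
  coeff_pos : ∀ z, ∀ θ ∈ Ioo 0 T, 0 < a z θ
  coeff_bounded : ∃ A, ∀ z, ∀ θ ∈ Ioo 0 T, a z θ ≤ A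
  bounded : ∃ M, ∀ z, ∀ θ ∈ Ioo 0 T, |d z θ| ≤ M
  coeff_continuousOn : ContinuousOn (fun p : ℝ × ℝ => a p.1 p.2) (univ ×ˢ Ioo 0 T)
  continuousOn : ContinuousOn (fun p : ℝ × ℝ => d p.1 p.2) (univ ×ˢ Ioo 0 T)
  continuousOn_time : ContinuousOn (fun p : ℝ × ℝ => d' p.1 p.2) (univ ×ˢ Ioo 0 T)
  hasDerivAt_time : ∀ z, ∀ θ ∈ Ioo 0 T, HasDerivAt (fun s => d z s) (d' z θ) θ
  hasDerivAt_space : ∀ z, ∀ θ ∈ Ioo 0 T, HasDerivAt (fun y => a y θ * d y θ) (g z θ) z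
  hasDerivAt_space_two : ∀ z, ∀ θ ∈ Ioo 0 T, HasDerivAt (fun y => g y θ) (d' z θ) z
  initial : ∀ z ≠ 0, Tendsto (fun θ => d z θ) (𝓝[>] 0) (𝓝 0)

lemma continuous_slice_space {T : ℝ} {f : ℝ → ℝ → ℝ}
    (hf : ContinuousOn (fun p : ℝ × ℝ => f p.1 p.2) (univ ×ˢ Ioo 0 T)) {s : ℝ} (hs : s ∈ Ioo 0 T) :
    Continuous fun z => f z s :=
  hf.comp_continuous (f := fun z : ℝ => (z, s)) (by fun_prop) fun z => ⟨mem_univ _, hs⟩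

lemma continuousOn_slice_time {T : ℝ} {f : ℝ → ℝ → ℝ}
    (hf : ContinuousOn (fun p : ℝ × ℝ => f p.1 p.2) (univ ×ˢ Ioo 0 T)) (z : ℝ) :
    ContinuousOn (fun s => f z s) (Ioo 0 T) :=
  hf.comp (f := fun s : ℝ => (z, s)) (by fun_prop) fun s hs => ⟨mem_univ _, hs⟩

lemma intervalIntegrable_of_continuousOn_of_bounded {T C α β : ℝ} {f : ℝ → ℝ}
    (hf : ContinuousOn f (Ioo 0 T)) (hC : ∀ s ∈ Ioo 0 T, |f s| ≤ C) (hα : α ∈ Ico 0 T)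
    (hβ : β ∈ Ico 0 T) : IntervalIntegrable f MeasureTheory.volume α β := by
  have hsub : uIoc α β ⊆ Ioo 0 T := fun x hx =>
    ⟨(le_min hα.1 hβ.1).trans_lt hx.1, hx.2.trans_lt (max_lt hα.2 hβ.2)⟩
  rw [intervalIntegrable_iff]
  refine MeasureTheory.IntegrableOn.of_bound (by simp) ?_ C ?_
  · exact (hf.mono hsub).aestronglyMeasurable measurableSet_uIoc
  · exact (MeasureTheory.ae_restrict_iff' measurableSet_uIoc).2
      (Eventually.of_forall fun x hx => hC x (hsub hx))

namespace IsLinearSolution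

variable {T : ℝ} {a d g d' : ℝ → ℝ → ℝ}

lemma neg (H : IsLinearSolution T a d g d') :
    IsLinearSolution T a (fun z θ => -d z θ) (fun z θ => -g z θ) (fun z θ => -d' z θ) where
  coeff_pos := H.coeff_pos
  coeff_bounded := H.coeff_bounded
  bounded := by simpa using H.bounded
  coeff_continuousOn := H.coeff_continuousOn
  continuousOn := H.continuousOn.neg
  continuousOn_time := H.continuousOn_time.neg
  hasDerivAt_time z θ hθ := (H.hasDerivAt_time z θ hθ).fun_neg
  hasDerivAt_space z θ hθ := by simpa using (H.hasDerivAt_space z θ hθ).fun_neg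
  hasDerivAt_space_two z θ hθ := (H.hasDerivAt_space_two z θ hθ).fun_neg
  initial z hz := by simpa using (H.initial z hz).neg

lemma flux_bounded (H : IsLinearSolution T a d g d') :
    ∃ C, 0 ≤ C ∧ ∀ z, ∀ θ ∈ Ioo 0 T, |a z θ * d z θ| ≤ C := by
  obtain ⟨A, hA⟩ := H.coeff_bounded
  obtain ⟨M, hM⟩ := H.bounded
  refine ⟨|A| * |M|, by positivity, fun z θ hθ => ?_⟩
  rw [abs_mul, abs_of_pos (H.coeff_pos z θ hθ)]
  exact mul_le_mul ((hA z θ hθ).trans (le_abs_self A)) ((hM z θ hθ).trans (le_abs_self M))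
    (abs_nonneg _) (abs_nonneg _)

/-- A weighted mean of `d` has the second difference of `a d` as its time derivative: this is the
equation tested against the tent function `h - |y - z|`. -/
lemma hasDerivAt_tent (H : IsLinearSolution T a d g d') (z : ℝ) {h : ℝ} (hh : 0 < h) {s : ℝ}
    (hs : s ∈ Ioo 0 T) :
    HasDerivAt (fun s => ∫ y in (0 : ℝ)..h, (h - y) * (d (z + y) s + d (z - y) s))
      (a (z + h) s * d (z + h) s + a (z - h) s * d (z - h) s - 2 * (a z s * d z s)) s := by
  have key : ∫ y in (0 : ℝ)..h, (h - y) * (d' (z + y) s + d' (z - y) s) =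
      a (z + h) s * d (z + h) s + a (z - h) s * d (z - h) s - 2 * (a z s * d z s) := by
    have hd' := continuous_slice_space H.continuousOn_time hs
    rw [intervalIntegral.integral_eq_sub_of_hasDerivAt (f := fun y =>
      (h - y) * (g (z + y) s - g (z - y) s) +
        (a (z + y) s * d (z + y) s + a (z - y) s * d (z - y) s))]
    · simp only [sub_self, add_zero, sub_zero, zero_mul, mul_zero]; ring
    · intro y _
      have h1 := (H.hasDerivAt_space_two (z + y) s hs).comp_const_add z y
      have h2 := (H.hasDerivAt_space_two (z - y) s hs).comp_const_sub z y
      have h3 := (H.hasDerivAt_space (z + y) s hs).comp_const_add z y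
      have h4 := (H.hasDerivAt_space (z - y) s hs).comp_const_sub z y
      have h5 := (hasDerivAt_id' y).const_sub h
      exact ((h5.fun_mul (h1.fun_sub h2)).fun_add (h3.fun_add h4)).congr_deriv (by ring)
    · exact Continuous.intervalIntegrable (by fun_prop) _ _
  rw [← key]
  set K : Set ℝ := Icc (s / 2) ((s + T) / 2) with hK
  have hKT : K ⊆ Ioo 0 T := fun x hx => ⟨by linarith [hx.1, hs.1], by linarith [hx.2, hs.2]⟩
  have hKn : K ∈ 𝓝 s := Icc_mem_nhds (by linarith [hs.1]) (by linarith [hs.2])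
  obtain ⟨B, hB⟩ := (isCompact_Icc (a := z - h) (b := z + h)).prod (isCompact_Icc
    (a := s / 2) (b := (s + T) / 2)) |>.exists_bound_of_continuousOn
      (H.continuousOn_time.mono (prod_mono (subset_univ _) hKT))
  refine (intervalIntegral.hasDerivAt_integral_of_dominated_loc_of_deriv_le (𝕜 := ℝ)
    (F := fun s y => (h - y) * (d (z + y) s + d (z - y) s))
    (F' := fun s y => (h - y) * (d' (z + y) s + d' (z - y) s)) (bound := fun _ => h * (B + B))
    hKn ?_ ?_ ?_ ?_ ?_ ?_).2
  · filter_upwards [hKn] with x hx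
    have := continuous_slice_space H.continuousOn (hKT hx)
    exact Continuous.aestronglyMeasurable (by fun_prop)
  · have := continuous_slice_space H.continuousOn hs
    exact Continuous.intervalIntegrable (by fun_prop) _ _
  · have := continuous_slice_space H.continuousOn_time hs
    exact Continuous.aestronglyMeasurable (by fun_prop)
  · refine Eventually.of_forall fun y hy x hx => ?_
    rw [uIoc_of_le hh.le] at hy
    have h1 := hB (z + y, x) ⟨⟨by linarith [hy.1], by linarith [hy.2]⟩, hx⟩
    have h2 := hB (z - y, x) ⟨⟨by linarith [hy.2], by linarith [hy.1]⟩, hx⟩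
    rw [norm_mul, Real.norm_of_nonneg (by linarith [hy.2] : 0 ≤ h - y)]
    exact mul_le_mul (by linarith [hy.1]) ((norm_add_le _ _).trans (add_le_add h1 h2))
      (norm_nonneg _) hh.le
  · exact intervalIntegrable_const
  · refine Eventually.of_forall fun y _ x hx => ?_
    exact ((H.hasDerivAt_time _ _ (hKT hx)).add (H.hasDerivAt_time _ _ (hKT hx))).const_mul _

lemma tendsto_tent (H : IsLinearSolution T a d g d') (hT : 0 < T) (z : ℝ) {h : ℝ} (hh : 0 < h) :
    Tendsto (fun s => ∫ y in (0 : ℝ)..h, (h - y) * (d (z + y) s + d (z - y) s)) (𝓝[>] 0) (𝓝 0) := by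
  obtain ⟨M, hM⟩ := H.bounded
  have hT' : ∀ᶠ s in 𝓝[>] (0 : ℝ), s ∈ Ioo 0 T := Ioo_mem_nhdsGT hT
  suffices Tendsto (fun s => ∫ y in (0 : ℝ)..h, (h - y) * (d (z + y) s + d (z - y) s)) (𝓝[>] 0)
      (𝓝 (∫ y in (0 : ℝ)..h, (h - y) * (0 + 0))) by simpa using this
  refine intervalIntegral.tendsto_integral_filter_of_dominated_convergence
    (fun _ => h * (M + M)) ?_ ?_ intervalIntegrable_const ?_
  · filter_upwards [hT'] with s hs
    have := continuous_slice_space H.continuousOn hs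
    exact Continuous.aestronglyMeasurable (by fun_prop)
  · filter_upwards [hT'] with s hs
    refine Eventually.of_forall fun y hy => ?_
    rw [uIoc_of_le hh.le] at hy
    rw [norm_mul, Real.norm_of_nonneg (by linarith [hy.2] : 0 ≤ h - y)]
    exact mul_le_mul (by linarith [hy.1])
      ((norm_add_le _ _).trans (add_le_add (hM _ _ hs) (hM _ _ hs))) (norm_nonneg _) hh.le
  · have hne : ∀ c : ℝ, ∀ᵐ y : ℝ, y ≠ c := fun c => by
      simp [MeasureTheory.ae_iff]
    filter_upwards [hne (-z), hne z] with y h1 h2 _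
    refine ((H.initial _ ?_).add (H.initial _ ?_)).const_mul _
    · contrapose! h1; linarith
    · contrapose! h2; linarith

/-- The time integral `E(z, θ) = ∫₀^θ a d` satisfies `∂²E/∂z² = d`, in the form tested against a
tent function. -/
lemma second_difference_integral (H : IsLinearSolution T a d g d') (z : ℝ) {h : ℝ} (hh : 0 < h)
    {θ : ℝ} (hθ : θ ∈ Ioo 0 T) :
    (∫ s in (0 : ℝ)..θ, a (z + h) s * d (z + h) s) + (∫ s in (0 : ℝ)..θ, a (z - h) s * d (z - h) s)
      - 2 * (∫ s in (0 : ℝ)..θ, a z s * d z s) =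
    ∫ y in (0 : ℝ)..h, (h - y) * (d (z + y) θ + d (z - y) θ) := by
  have hT : 0 < T := hθ.1.trans hθ.2
  obtain ⟨C, -, hC⟩ := H.flux_bounded
  have hi : ∀ x, IntervalIntegrable (fun s => a x s * d x s) MeasureTheory.volume 0 θ := fun x =>
    intervalIntegrable_of_continuousOn_of_bounded
      ((continuousOn_slice_time H.coeff_continuousOn x).mul
        (continuousOn_slice_time H.continuousOn x)) (hC x) ⟨le_rfl, hT⟩ ⟨hθ.1.le, hθ.2⟩
  rw [← intervalIntegral.integral_const_mul, ← intervalIntegral.integral_add (hi _) (hi _),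
    ← intervalIntegral.integral_sub ((hi _).add (hi _)) ((hi _).const_mul _),
    intervalIntegral.integral_eq_sub_of_hasDerivAt_of_tendsto hθ.1
      (fun s hs => H.hasDerivAt_tent z hh ⟨hs.1, hs.2.trans hθ.2⟩)
      (((hi _).add (hi _)).sub ((hi _).const_mul _)) (H.tendsto_tent hT z hh)
      ((H.hasDerivAt_tent z hh hθ).continuousAt.tendsto.mono_left nhdsWithin_le_nhds), sub_zero]

lemma continuousOn_integral (H : IsLinearSolution T a d g d') {θ : ℝ} (hθ : θ ∈ Ioo 0 T) :
    ContinuousOn (fun p : ℝ × ℝ => ∫ s in (0 : ℝ)..p.2, a p.1 s * d p.1 s) (univ ×ˢ Icc 0 θ) := by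
  have hT : 0 < T := hθ.1.trans hθ.2
  obtain ⟨C, hC0, hC⟩ := H.flux_bounded
  have hi : ∀ x, ∀ t ∈ Icc 0 θ,
      IntervalIntegrable (fun s => a x s * d x s) MeasureTheory.volume 0 t := fun x t ht =>
    intervalIntegrable_of_continuousOn_of_bounded
      ((continuousOn_slice_time H.coeff_continuousOn x).mul
        (continuousOn_slice_time H.continuousOn x)) (hC x) ⟨le_rfl, hT⟩ ⟨ht.1, ht.2.trans_lt hθ.2⟩
  refine continuousOn_prod_of_continuousOn_lipschitzOnWith' _ ⟨C, hC0⟩ (fun z _ => ?_)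
    fun t ht => Continuous.continuousOn ?_
  · refine LipschitzOnWith.of_dist_le_mul fun t ht t' ht' => ?_
    rw [Real.dist_eq, Real.dist_eq, intervalIntegral.integral_interval_sub_left (hi z t ht)
      (hi z t' ht')]
    refine intervalIntegral.norm_integral_le_of_norm_le_const (f := fun s => a z s * d z s)
      (C := C) fun x hx => hC z x ?_
    exact ⟨(le_min ht'.1 ht.1).trans_lt hx.1, (hx.2.trans (max_le ht'.2 ht.2)).trans_lt hθ.2⟩
  · have hsub : ∀ s ∈ uIoc 0 t, s ∈ Ioo 0 T := fun s hs => by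
      rw [uIoc_of_le ht.1] at hs
      exact ⟨hs.1, (hs.2.trans ht.2).trans_lt hθ.2⟩
    refine intervalIntegral.continuous_of_dominated_interval (bound := fun _ => C) (fun z => ?_)
      (fun z => Eventually.of_forall fun s hs => hC z s (hsub s hs)) intervalIntegrable_const
      (Eventually.of_forall fun s hs => ?_)
    · exact (((continuousOn_slice_time H.coeff_continuousOn z).mul
        (continuousOn_slice_time H.continuousOn z)).mono hsub).aestronglyMeasurable
          measurableSet_uIoc
    · exact (continuous_slice_space H.coeff_continuousOn (hsub s hs)).mul
        (continuous_slice_space H.continuousOn (hsub s hs))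

lemma hasDerivAt_integral (H : IsLinearSolution T a d g d') (z : ℝ) {θ : ℝ} (hθ : θ ∈ Ioo 0 T) :
    HasDerivAt (fun t => ∫ s in (0 : ℝ)..t, a z s * d z s) (a z θ * d z θ) θ := by
  have hT : 0 < T := hθ.1.trans hθ.2
  obtain ⟨C, hC0, hC⟩ := H.flux_bounded
  have hc := (continuousOn_slice_time H.coeff_continuousOn z).mul
        (continuousOn_slice_time H.continuousOn z)
  refine intervalIntegral.integral_hasDerivAt_right
    (intervalIntegrable_of_continuousOn_of_bounded hc (hC z) ⟨le_rfl, hT⟩ ⟨hθ.1.le, hθ.2⟩) ?_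
    (hc.continuousAt (Ioo_mem_nhds hθ.1 hθ.2))
  exact hc.stronglyMeasurableAtFilter isOpen_Ioo _ hθ

end IsLinearSolution

/-! ### Uniqueness for the porous medium equation -/

namespace IsLinearSolution

variable {T : ℝ} {a d g d' : ℝ → ℝ → ℝ}

/-- Maximum principle for the time integral `E` of `a d`, with the barrier `η (z² + K θ)`: since
`∂E/∂θ = a d = a ∂²E/∂z²`, a positive maximum of `E - η (z² + K θ)` would force
`η K ≤ a d ≤ 2 η a`. -/
lemma integral_le_barrier (H : IsLinearSolution T a d g d') {A : ℝ}
    (hA : ∀ z, ∀ θ ∈ Ioo 0 T, a z θ ≤ A) {η : ℝ} (hη : 0 < η) (z₀ : ℝ) {θ₀ : ℝ}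
    (hθ₀ : θ₀ ∈ Ioo 0 T) :
    ∫ s in (0 : ℝ)..θ₀, a z₀ s * d z₀ s ≤ η * (z₀ ^ 2 + (2 * A + 1) * θ₀) := by
  have hApos : 0 < A := (H.coeff_pos 0 θ₀ hθ₀).trans_le (hA 0 θ₀ hθ₀)
  obtain ⟨C, hC0, hC⟩ := H.flux_bounded
  set E : ℝ → ℝ → ℝ := fun z t => ∫ s in (0 : ℝ)..t, a z s * d z s with hE
  set Φ : ℝ × ℝ → ℝ := fun p => E p.1 p.2 - η * (p.1 ^ 2 + (2 * A + 1) * p.2) with hΦ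
  by_contra! hlt
  have hpos : 0 < Φ (z₀, θ₀) := by simp only [hΦ, hE]; linarith
  have hEb : ∀ z, ∀ t ∈ Icc 0 θ₀, E z t ≤ C * θ₀ := fun z t ht => by
    have := intervalIntegral.norm_integral_le_of_norm_le_const (f := fun s => a z s * d z s)
      (a := 0) (b := t) (C := C) fun x hx => by
        rw [uIoc_of_le ht.1] at hx
        exact hC z x ⟨hx.1, (hx.2.trans ht.2).trans_lt hθ₀.2⟩
    rw [sub_zero, abs_of_nonneg ht.1] at this
    exact (le_abs_self _).trans (this.trans (mul_le_mul_of_nonneg_left ht.2 hC0))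
  -- The barrier beats `E ≤ C θ₀` outside `[-R, R]`.
  set R : ℝ := 1 + C * θ₀ / η with hR
  have hq0 : 0 ≤ C * θ₀ / η := div_nonneg (mul_nonneg hC0 hθ₀.1.le) hη.le
  have hout : ∀ z, ∀ t ∈ Icc 0 θ₀, R ≤ |z| → Φ (z, t) ≤ 0 := fun z t ht hz => by
    have h1 : C * θ₀ / η ≤ z ^ 2 := by
      rw [← sq_abs]; nlinarith
    have h2 : C * θ₀ ≤ η * z ^ 2 := by
      rw [div_le_iff₀ hη] at h1; linarith
    have h3 : 0 ≤ η * ((2 * A + 1) * t) := by have := ht.1; positivity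
    simp only [hΦ]
    linarith [hEb z t ht]
  have hcont : ContinuousOn Φ (Icc (-R) R ×ˢ Icc 0 θ₀) := by
    refine ContinuousOn.sub ((H.continuousOn_integral hθ₀).mono ?_) (by fun_prop)
    exact prod_mono (subset_univ _) subset_rfl
  have hz₀ : |z₀| < R := by
    by_contra! h
    exact absurd (hout z₀ θ₀ ⟨hθ₀.1.le, le_rfl⟩ h) (not_le.2 hpos)
  have hmem₀ : (z₀, θ₀) ∈ Icc (-R) R ×ˢ Icc 0 θ₀ :=
    ⟨⟨(abs_lt.1 hz₀).1.le, (abs_lt.1 hz₀).2.le⟩, hθ₀.1.le, le_rfl⟩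
  obtain ⟨⟨z, θ⟩, ⟨-, hθ⟩, hmax⟩ := (isCompact_Icc.prod isCompact_Icc).exists_isMaxOn
    ⟨_, hmem₀⟩ hcont
  have hΦpos : 0 < Φ (z, θ) := hpos.trans_le (hmax hmem₀)
  have hglob : ∀ y, ∀ t ∈ Icc 0 θ₀, Φ (y, t) ≤ Φ (z, θ) := fun y t ht => by
    rcases le_or_gt R |y| with h | h
    · exact (hout y t ht h).trans hΦpos.le
    · exact hmax ⟨⟨(abs_lt.1 h).1.le, (abs_lt.1 h).2.le⟩, ht⟩
  have hθpos : 0 < θ := by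
    rcases hθ.1.lt_or_eq with h | h
    · exact h
    · exfalso
      change 0 = θ at h
      simp only [hΦ, hE, ← h, intervalIntegral.integral_same] at hΦpos
      nlinarith [sq_nonneg z]
  have hθT : θ ∈ Ioo 0 T := ⟨hθpos, hθ.2.trans_lt hθ₀.2⟩
  have hspace : d z θ ≤ 2 * η := by
    by_contra! hd
    have hdc := continuous_slice_space H.continuousOn hθT
    have hev : ∀ᶠ y in 𝓝 z, 2 * η < d y θ := hdc.continuousAt.eventually_const_lt hd
    obtain ⟨h, hh, hball⟩ := Metric.eventually_nhds_iff.1 hev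
    have hh2 : 0 < h / 2 := by linarith
    have h1 := H.second_difference_integral z hh2 hθT
    have h2 := hglob (z + h / 2) θ hθ
    have h3 := hglob (z - h / 2) θ hθ
    have h4 : ∫ y in (0 : ℝ)..(h / 2), (h / 2 - y) * (4 * η) <
        ∫ y in (0 : ℝ)..(h / 2), (h / 2 - y) * (d (z + y) θ + d (z - y) θ) := by
      refine intervalIntegral.integral_lt_integral_of_continuousOn_of_le_of_exists_lt hh2
        (by fun_prop) (by fun_prop) (fun y hy => ?_) ⟨0, ⟨le_rfl, hh2.le⟩, ?_⟩
      · have e1 : 2 * η < d (z + y) θ := hball (by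
          rw [Real.dist_eq, add_sub_cancel_left, abs_of_pos hy.1]; linarith [hy.2])
        have e2 : 2 * η < d (z - y) θ := hball (by
          rw [Real.dist_eq, sub_sub_cancel_left, abs_neg, abs_of_pos hy.1]; linarith [hy.2])
        exact mul_le_mul_of_nonneg_left (by linarith) (by linarith [hy.2])
      · simp only [sub_zero, add_zero]
        exact mul_lt_mul_of_pos_left (by linarith) hh2
    have h5 : ∫ y in (0 : ℝ)..(h / 2), (h / 2 - y) * (4 * η) = 2 * η * (h / 2) ^ 2 := by
      rw [intervalIntegral.integral_mul_const, intervalIntegral.integral_sub (by simp) (by simp)]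
      simp; ring
    simp only [hΦ, hE] at h2 h3
    nlinarith
  have htime : η * (2 * A + 1) ≤ a z θ * d z θ := by
    by_contra! hlt
    have hder : HasDerivAt (fun t => Φ (z, t)) (a z θ * d z θ - η * (0 + (2 * A + 1))) θ := by
      have := (((hasDerivAt_id' θ).const_mul (2 * A + 1)).const_add (z ^ 2)).const_mul η
      refine ((H.hasDerivAt_integral z hθT).fun_sub this).congr_deriv (by ring)
    have hev := (hasDerivAt_iff_tendsto_slope.1 hder).eventually_lt_const
      (show a z θ * d z θ - η * (0 + (2 * A + 1)) < 0 by linarith)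
    have hev2 : ∀ᶠ t in 𝓝[<] θ, slope (fun t => Φ (z, t)) θ t < 0 :=
      hev.filter_mono (nhdsWithin_mono _ fun x hx => ne_of_lt hx)
    obtain ⟨t, ht, ht1, ht2⟩ := (hev2.and (Ioo_mem_nhdsLT hθpos)).exists
    have := hglob z t ⟨ht1.le, ht2.le.trans hθ.2⟩
    rw [slope_def_field, div_neg_iff] at ht
    rcases ht with h | h <;> linarith [h.1, h.2]
  nlinarith [hA z θ hθT, H.coeff_pos z θ hθT]

/-- Bounded solutions of `∂d/∂θ = ∂²(a d)/∂z²` with vanishing initial value vanish. -/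
theorem eq_zero (H : IsLinearSolution T a d g d') (z : ℝ) {θ : ℝ} (hθ : θ ∈ Ioo 0 T) :
    d z θ = 0 := by
  obtain ⟨A, hA⟩ := H.coeff_bounded
  have hle : ∀ {d g d' : ℝ → ℝ → ℝ}, IsLinearSolution T a d g d' → ∀ t ∈ Ioo 0 T,
      ∫ s in (0 : ℝ)..t, a z s * d z s ≤ 0 := fun {d g d'} H t ht => by
    have h : Tendsto (fun η : ℝ => η * (z ^ 2 + (2 * A + 1) * t)) (𝓝[>] 0)
        (𝓝 (0 * (z ^ 2 + (2 * A + 1) * t))) :=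
      ((continuous_id.mul continuous_const).tendsto 0).mono_left nhdsWithin_le_nhds
    rw [zero_mul] at h
    exact ge_of_tendsto h (eventually_mem_nhdsWithin.mono fun η hη =>
      H.integral_le_barrier hA hη z ht)
  have hE : ∀ t ∈ Ioo 0 T, ∫ s in (0 : ℝ)..t, a z s * d z s = 0 := fun t ht => by
    refine le_antisymm (hle H t ht) ?_
    have := hle H.neg t ht
    simp only [mul_neg, intervalIntegral.integral_neg] at this
    linarith
  have h0 : HasDerivAt (fun t => ∫ s in (0 : ℝ)..t, a z s * d z s) 0 θ :=
    (hasDerivAt_const θ (0 : ℝ)).congr_of_eventuallyEq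
      (Filter.eventually_of_mem (Ioo_mem_nhds hθ.1 hθ.2) hE)
  have := (H.hasDerivAt_integral z hθ).unique h0
  exact (mul_eq_zero.1 this).resolve_left (H.coeff_pos z θ hθ).ne'

end IsLinearSolution

lemma IsPMESolution.hasDerivAt_flux {δ εm εp T : ℝ} {w : ℝ → ℝ → ℝ}
    (hw : IsPMESolution δ εm εp T w) (z : ℝ) {θ : ℝ} (hθ : θ ∈ Ioo 0 T) :
    HasDerivAt (fun y => δ / 2 * w y θ ^ 2) (δ * w z θ * deriv (fun x => w x θ) z) z ∧
    HasDerivAt (fun y => δ * w y θ * deriv (fun x => w x θ) y) (deriv (fun s => w z s) θ) z := by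
  have h := hw.contDiff_space θ hθ
  have h1 : ∀ z, HasDerivAt (fun y => w y θ) (deriv (fun x => w x θ) z) z := fun z =>
    (h.differentiable (by norm_num) z).hasDerivAt
  have h2 : Differentiable ℝ (deriv fun x => w x θ) :=
    (contDiff_succ_iff_deriv.1 (show ContDiff ℝ (1 + 1) _ from h)).2.2.differentiable (by norm_num)
  refine ⟨(((h1 z).fun_pow 2).const_mul (δ / 2)).congr_deriv (by norm_num; ring), ?_⟩
  rw [hw.pde z θ hθ]
  exact (((h1 z).const_mul δ).fun_mul (h2 z).hasDerivAt).differentiableAt.hasDerivAt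

/-- The difference of two solutions `w`, `v` of the porous medium equation solves the linear
equation with coefficient `δ (w + v) / 2`. -/
lemma IsPMESolution.sub {δ εm εp T : ℝ} (hδ : 0 < δ) {w v : ℝ → ℝ → ℝ}
    (hw : IsPMESolution δ εm εp T w) (hv : IsPMESolution δ εm εp T v) :
    IsLinearSolution T (fun z θ => δ / 2 * (w z θ + v z θ)) (fun z θ => w z θ - v z θ)
      (fun z θ => δ * w z θ * deriv (fun x => w x θ) z - δ * v z θ * deriv (fun x => v x θ) z)
      (fun z θ => deriv (fun s => w z s) θ - deriv (fun s => v z s) θ) where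
  coeff_pos z θ hθ := by have := hw.pos z θ hθ; have := hv.pos z θ hθ; positivity
  coeff_bounded := by
    obtain ⟨M, hM⟩ := hw.bounded
    obtain ⟨N, hN⟩ := hv.bounded
    exact ⟨δ / 2 * (M + N), fun z θ hθ =>
      mul_le_mul_of_nonneg_left (add_le_add (hM z θ hθ) (hN z θ hθ)) (by positivity)⟩
  bounded := by
    obtain ⟨M, hM⟩ := hw.bounded
    obtain ⟨N, hN⟩ := hv.bounded
    refine ⟨M + N, fun z θ hθ => abs_le.2 ⟨?_, ?_⟩⟩ <;>
    linarith [hM z θ hθ, hN z θ hθ, hw.pos z θ hθ, hv.pos z θ hθ]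
  coeff_continuousOn := continuousOn_const.mul (hw.continuousOn.add hv.continuousOn)
  continuousOn := hw.continuousOn.sub hv.continuousOn
  continuousOn_time := hw.continuousOn_time.sub hv.continuousOn_time
  hasDerivAt_time z θ hθ :=
    (hw.differentiable_time z θ hθ).hasDerivAt.fun_sub (hv.differentiable_time z θ hθ).hasDerivAt
  hasDerivAt_space z θ hθ := by
    refine ((hw.hasDerivAt_flux z hθ).1.fun_sub (hv.hasDerivAt_flux z hθ).1).congr_of_eventuallyEq
      (Eventually.of_forall fun y => ?_)
    simp only; ring
  hasDerivAt_space_two z θ hθ := (hw.hasDerivAt_flux z hθ).2.fun_sub (hv.hasDerivAt_flux z hθ).2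
  initial z hz := by
    rcases hz.lt_or_gt with h | h
    · simpa using (hw.initial_neg z h).sub (hv.initial_neg z h)
    · simpa using (hw.initial_pos z h).sub (hv.initial_pos z h)

theorem IsPMESolution.unique {δ εm εp T : ℝ} (hδ : 0 < δ) {w v : ℝ → ℝ → ℝ}
    (hw : IsPMESolution δ εm εp T w) (hv : IsPMESolution δ εm εp T v) (z : ℝ) {θ : ℝ}
    (hθ : θ ∈ Ioo 0 T) : w z θ = v z θ :=
  sub_eq_zero.1 ((hw.sub hδ hv).eq_zero z hθ)

/-! ### Self-similar solutions and uniqueness of the profile -/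

lemma bddAbove_range_of_tendsto {u : ℝ → ℝ} (hu : Continuous u) {a b : ℝ}
    (ha : Tendsto u atBot (𝓝 a)) (hb : Tendsto u atTop (𝓝 b)) : ∃ M, ∀ x, u x ≤ M := by
  obtain ⟨s, hs⟩ := (ha.eventually_le_const (lt_add_one a)).exists_forall_of_atBot
  obtain ⟨t, ht⟩ := (hb.eventually_le_const (lt_add_one b)).exists_forall_of_atTop
  obtain ⟨M, hM⟩ := (isCompact_Icc (a := s) (b := t)).bddAbove_image hu.continuousOn
  refine ⟨max M (max (a + 1) (b + 1)), fun x => ?_⟩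
  rcases le_total x s with h | h
  · exact (hs x h).trans ((le_max_left _ _).trans (le_max_right _ _))
  rcases le_total t x with h' | h'
  · exact (ht x h').trans ((le_max_right _ _).trans (le_max_right _ _))
  · exact (hM (mem_image_of_mem u ⟨h, h'⟩)).trans (le_max_left _ _)

namespace IsProfile

variable {δ lam εm εp : ℝ} {u : ℝ → ℝ}

lemma hasDerivAt (hu : IsProfile δ lam εm εp u) (x : ℝ) : HasDerivAt u (deriv u x) x :=
  (hu.contDiff.differentiable (by norm_num) x).hasDerivAt

lemma contDiff_deriv (hu : IsProfile δ lam εm εp u) : ContDiff ℝ 1 (deriv u) :=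
  (contDiff_succ_iff_deriv.1 (show ContDiff ℝ (1 + 1) _ from hu.contDiff)).2.2

lemma hasDerivAt_deriv (hu : IsProfile δ lam εm εp u) (x : ℝ) :
    HasDerivAt (deriv u) (deriv (deriv u) x) x :=
  (hu.contDiff_deriv.differentiable (by norm_num) x).hasDerivAt

lemma continuous_deriv_deriv (hu : IsProfile δ lam εm εp u) : Continuous (deriv (deriv u)) :=
  hu.contDiff_deriv.continuous_deriv le_rfl

lemma hasDerivAt_selfSimilar_space (hu : IsProfile δ lam εm εp u) (z θ : ℝ) :
    HasDerivAt (fun y => selfSimilar lam u y θ) (deriv u ((z - lam * √θ) / √θ) / √θ) z := by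
  have h : HasDerivAt (fun y => (y - lam * √θ) / √θ) (1 / √θ) z :=
    ((hasDerivAt_id' z).sub_const _).div_const _
  exact ((hu.hasDerivAt _).comp z h).congr_deriv (by ring)

lemma hasDerivAt_selfSimilar_space_two (hu : IsProfile δ lam εm εp u) (z : ℝ) {θ : ℝ}
    (hθ : 0 < θ) :
    HasDerivAt (fun y => deriv u ((y - lam * √θ) / √θ) / √θ)
      (deriv (deriv u) ((z - lam * √θ) / √θ) / θ) z := by
  have h : HasDerivAt (fun y => (y - lam * √θ) / √θ) (1 / √θ) z :=
    ((hasDerivAt_id' z).sub_const _).div_const _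
  refine (((hu.hasDerivAt_deriv _).comp z h).div_const (√θ)).congr_deriv ?_
  have hs : √θ ≠ 0 := (Real.sqrt_pos.2 hθ).ne'
  rw [mul_one_div, div_div, Real.mul_self_sqrt hθ.le]

lemma hasDerivAt_selfSimilar_time (hu : IsProfile δ lam εm εp u) (z : ℝ) {θ : ℝ} (hθ : 0 < θ) :
    HasDerivAt (fun s => selfSimilar lam u z s)
      (deriv u ((z - lam * √θ) / √θ) * (-z / (2 * θ * √θ))) θ := by
  have hs : √θ ≠ 0 := (Real.sqrt_pos.2 hθ).ne'
  have hr : HasDerivAt (fun s => √s) (1 / (2 * √θ)) θ := Real.hasDerivAt_sqrt hθ.ne'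
  have h : HasDerivAt (fun s => (z - lam * √s) / √s) (-z / (2 * θ * √θ)) θ := by
    refine (((hr.const_mul lam).const_sub z).fun_div hr hs).congr_deriv ?_
    have h3 : (2 * θ * √θ) = 2 * √θ ^ 3 := by rw [pow_succ, Real.sq_sqrt hθ.le]; ring
    rw [h3]
    field_simp
    ring
  exact (hu.hasDerivAt _).comp θ h

lemma isPMESolution_selfSimilar (hu : IsProfile δ lam εm εp u) (T : ℝ) :
    IsPMESolution δ εm εp T (selfSimilar lam u) := by
  have hsp : ∀ θ, deriv (fun y => selfSimilar lam u y θ) =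
      fun z => deriv u ((z - lam * √θ) / √θ) / √θ := fun θ =>
    funext fun z => (hu.hasDerivAt_selfSimilar_space z θ).deriv
  have hsp2 : ∀ z, ∀ θ ∈ Ioo 0 T, deriv (deriv (fun y => selfSimilar lam u y θ)) z =
      deriv (deriv u) ((z - lam * √θ) / √θ) / θ := fun z θ hθ => by
    rw [hsp]; exact (hu.hasDerivAt_selfSimilar_space_two z hθ.1).deriv
  have htm : ∀ z, ∀ θ ∈ Ioo 0 T, deriv (fun s => selfSimilar lam u z s) θ =
      deriv u ((z - lam * √θ) / √θ) * (-z / (2 * θ * √θ)) := fun z θ hθ =>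
    (hu.hasDerivAt_selfSimilar_time z hθ.1).deriv
  have hne : ∀ p ∈ (univ : Set ℝ) ×ˢ Ioo 0 T, √p.2 ≠ 0 := fun p hp =>
    (Real.sqrt_pos.2 hp.2.1).ne'
  have hne' : ∀ p ∈ (univ : Set ℝ) ×ˢ Ioo 0 T, p.2 ≠ 0 := fun p hp => hp.2.1.ne'
  have hξ : ContinuousOn (fun p : ℝ × ℝ => (p.1 - lam * √p.2) / √p.2) (univ ×ˢ Ioo 0 T) :=
    ContinuousOn.div (by fun_prop) (by fun_prop) hne
  -- In the similarity variable, `ξ + lam = z / √θ`.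
  have hlim : ∀ z, (fun θ => selfSimilar lam u z θ) =ᶠ[𝓝[>] 0]
      fun θ => u (z * (√θ)⁻¹ + -lam) := fun z => by
    filter_upwards [self_mem_nhdsWithin] with θ hθ
    have : √θ ≠ 0 := (Real.sqrt_pos.2 hθ).ne'
    unfold selfSimilar
    congr 1
    field_simp
    ring
  have hinv : Tendsto (fun θ : ℝ => (√θ)⁻¹) (𝓝[>] 0) atTop := by
    refine tendsto_inv_nhdsGT_zero.comp (tendsto_nhdsWithin_iff.2 ⟨?_, ?_⟩)
    · have := Real.continuous_sqrt.tendsto 0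
      rw [Real.sqrt_zero] at this
      exact this.mono_left nhdsWithin_le_nhds
    · filter_upwards [self_mem_nhdsWithin] with θ hθ using Real.sqrt_pos.2 hθ
  refine ⟨fun z θ _ => hu.pos _, ?_, fun θ _ => ?_, fun z θ hθ => ?_, ?_, ?_, ?_, ?_, ?_, ?_, ?_⟩
  · obtain ⟨M, hM⟩ := bddAbove_range_of_tendsto hu.contDiff.continuous hu.tendsto_atBot
      hu.tendsto_atTop
    exact ⟨M, fun z θ _ => hM _⟩
  · exact hu.contDiff.comp ((contDiff_id.sub contDiff_const).div_const _)
  · exact (hu.hasDerivAt_selfSimilar_time z hθ.1).differentiableAt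
  · exact hu.contDiff.continuous.comp_continuousOn hξ
  · refine ContinuousOn.congr ?_ fun p hp => htm p.1 p.2 hp.2
    refine (hu.contDiff_deriv.continuous.comp_continuousOn hξ).mul
      (ContinuousOn.div (by fun_prop) (by fun_prop) fun p hp => ?_)
    exact mul_ne_zero (mul_ne_zero two_ne_zero (hne' p hp)) (hne p hp)
  · simp only [hsp]
    exact (hu.contDiff_deriv.continuous.comp_continuousOn hξ).div (by fun_prop) hne
  · refine ContinuousOn.congr ?_ fun p hp => hsp2 p.1 p.2 hp.2
    exact (hu.continuous_deriv_deriv.comp_continuousOn hξ).div (by fun_prop) hne'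
  · intro z θ hθ
    have hs : √θ ≠ 0 := (Real.sqrt_pos.2 hθ.1).ne'
    rw [htm z θ hθ, hsp]
    have h := ((hu.hasDerivAt_selfSimilar_space z θ).const_mul δ).fun_mul
      (hu.hasDerivAt_selfSimilar_space_two z hθ.1)
    rw [h.deriv]
    have hode := hu.ode ((z - lam * √θ) / √θ)
    have e1 : (z - lam * √θ) / √θ + lam = z / √θ := by field_simp; ring
    rw [e1] at hode
    have e2 : ∀ a b : ℝ, a / √θ * (b / √θ) = a * b / θ := fun a b => by
      rw [div_mul_div_comm, Real.mul_self_sqrt hθ.1.le]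
    unfold selfSimilar
    generalize deriv u ((z - lam * √θ) / √θ) = p at *
    generalize deriv (deriv u) ((z - lam * √θ) / √θ) = q at *
    generalize u ((z - lam * √θ) / √θ) = v at *
    have e3 : δ * (p / √θ) * (p / √θ) + δ * v * (q / θ) = (δ * p ^ 2 + δ * (v * q)) / θ := by
      rw [mul_assoc, e2]; ring
    have e4 : p * (-z / (2 * θ * √θ)) = -(z / √θ * p / 2) / θ := by
      have := hθ.1.ne'; field_simp
    rw [e3, e4]
    congr 1
    linarith
  · intro z hz
    refine (hu.tendsto_atBot.comp ?_).congr' (hlim z).symm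
    exact tendsto_atBot_add_const_right _ _ (hinv.const_mul_atTop_of_neg hz)
  · intro z hz
    refine (hu.tendsto_atTop.comp ?_).congr' (hlim z).symm
    exact tendsto_atTop_add_const_right _ _ (hinv.const_mul_atTop hz)

/-- A profile is the value at time one of its self-similar solution, so uniqueness for the porous
medium equation gives uniqueness of the profile. -/
theorem unique (hδ : 0 < δ) {v : ℝ → ℝ} (hu : IsProfile δ lam εm εp u)
    (hv : IsProfile δ lam εm εp v) : u = v := by
  funext ξ
  have h := (hu.isPMESolution_selfSimilar 2).unique hδ (hv.isPMESolution_selfSimilar 2) (ξ + lam)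
    (θ := 1) ⟨by norm_num, by norm_num⟩
  simpa [selfSimilar] using h

lemma comp_add (hu : IsProfile δ lam εm εp u) (c : ℝ) :
    IsProfile δ (lam + c) εm εp (fun ξ => u (ξ + c)) := by
  have h1 : deriv (fun ξ => u (ξ + c)) = fun ξ => deriv u (ξ + c) :=
    funext fun ξ => deriv_comp_add_const u c ξ
  refine ⟨hu.contDiff.comp (contDiff_id.add contDiff_const), fun ξ => hu.pos _, fun ξ => ?_,
    hu.tendsto_atBot.comp (tendsto_atBot_add_const_right _ _ tendsto_id),
    hu.tendsto_atTop.comp (tendsto_atTop_add_const_right _ _ tendsto_id)⟩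
  rw [h1, deriv_comp_add_const (deriv u) c ξ]
  have := hu.ode (ξ + c)
  rw [← this]; ring

end IsProfile

/-! ### The fixed-point operator for the profile equation -/

/-- The solution with value one at the origin of `δ G' = -ξ G / (2 u)`. For a profile `u` with
`lam = 0` this is the equation satisfied by the derivative of `u ^ 2`. -/
noncomputable def profileWeight (δ : ℝ) (u : ℝ → ℝ) (r : ℝ) : ℝ :=
  Real.exp (-∫ s in (0 : ℝ)..r, s / (2 * δ * u s))

/-- Measurable functions with values in `[m, N]`. -/
structure IsBetween (m N : ℝ) (u : ℝ → ℝ) : Prop where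
  measurable : Measurable u
  le : ∀ x, m ≤ u x
  ge : ∀ x, u x ≤ N

/-- `u` is a positive fixed point of `u ↦ √(m ^ 2 + q ∫_{-∞}^ξ G u)`, with `G u` the weight
`profileWeight δ u`. The constant `q` is the derivative of `u ^ 2` at the origin. -/
def IsFixedProfile (δ m q : ℝ) (u : ℝ → ℝ) : Prop :=
  ∀ ξ, u ξ = √(m ^ 2 + q * ∫ r in Iic ξ, profileWeight δ u r)

section Weight

variable {δ m N : ℝ} {u v : ℝ → ℝ}

lemma IsBetween.const (hmN : m ≤ N) : IsBetween m N fun _ => m :=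
  ⟨measurable_const, fun _ => le_rfl, fun _ => hmN⟩

lemma IsBetween.const_right (hmN : m ≤ N) : IsBetween m N fun _ => N :=
  ⟨measurable_const, fun _ => hmN, fun _ => le_rfl⟩

lemma IsBetween.abs_div_le (hδ : 0 < δ) (hm : 0 < m) (hu : IsBetween m N u) (s : ℝ) :
    |s / (2 * δ * u s)| ≤ |s| / (2 * δ * m) := by
  have h1 : 0 < u s := hm.trans_le (hu.le s)
  rw [abs_div, abs_of_pos (by positivity : 0 < 2 * δ * u s)]
  exact div_le_div_of_nonneg_left (abs_nonneg s) (by positivity)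
    (mul_le_mul_of_nonneg_left (hu.le s) (by positivity))

lemma IsBetween.intervalIntegrable (hδ : 0 < δ) (hm : 0 < m) (hu : IsBetween m N u) (a b : ℝ) :
    IntervalIntegrable (fun s => s / (2 * δ * u s)) MeasureTheory.volume a b := by
  have hb : IntervalIntegrable (fun s : ℝ => |s| / (2 * δ * m)) MeasureTheory.volume a b :=
    Continuous.intervalIntegrable (by fun_prop) _ _
  refine hb.mono_fun ?_ (Eventually.of_forall fun s => ?_)
  · exact (measurable_id.div (hu.measurable.const_mul _)).aestronglyMeasurable
  · exact (hu.abs_div_le hδ hm s).trans (le_abs_self _)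

lemma profileWeight_pos (r : ℝ) : 0 < profileWeight δ u r := Real.exp_pos _

lemma profileWeight_zero : profileWeight δ u 0 = 1 := by simp [profileWeight]

lemma profileWeight_const (N r : ℝ) :
    profileWeight δ (fun _ => N) r = Real.exp (-(4 * δ * N)⁻¹ * r ^ 2) := by
  unfold profileWeight
  rw [intervalIntegral.integral_div, integral_id]
  congr 1
  rw [show 4 * δ * N = 2 * (2 * δ * N) by ring, mul_inv]
  ring

/-- The weight is monotone in `u` on both half-lines, because the exponent is an integral away from
the origin of a quantity whose sign is that of the variable. -/
lemma profileWeight_mono (hδ : 0 < δ) (hm : 0 < m) (hu : IsBetween m N u) (hv : IsBetween m N v)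
    (huv : ∀ x, u x ≤ v x) (r : ℝ) : profileWeight δ u r ≤ profileWeight δ v r := by
  refine Real.exp_le_exp.2 (neg_le_neg ?_)
  have hu0 : ∀ s, 0 < 2 * δ * u s := fun s => by
    have := hm.trans_le (hu.le s); positivity
  have hv0 : ∀ s, 2 * δ * u s ≤ 2 * δ * v s := fun s =>
    mul_le_mul_of_nonneg_left (huv s) (by positivity)
  rcases le_total 0 r with hr | hr
  · exact intervalIntegral.integral_mono_on hr (hv.intervalIntegrable hδ hm _ _)
      (hu.intervalIntegrable hδ hm _ _) fun s hs =>
        div_le_div_of_nonneg_left hs.1 (hu0 s) (hv0 s)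
  · rw [intervalIntegral.integral_symm r 0, intervalIntegral.integral_symm r 0]
    refine neg_le_neg (intervalIntegral.integral_mono_on hr (hu.intervalIntegrable hδ hm _ _)
      (hv.intervalIntegrable hδ hm _ _) fun s hs => ?_)
    have := div_le_div_of_nonneg_left (neg_nonneg.2 hs.2) (hu0 s) (hv0 s)
    rw [neg_div, neg_div] at this
    exact neg_le_neg_iff.1 this

lemma IsBetween.left_le_right (hu : IsBetween m N u) : m ≤ N := (hu.le 0).trans (hu.ge 0)

lemma IsBetween.weight_le (hδ : 0 < δ) (hm : 0 < m) (hu : IsBetween m N u) (r : ℝ) :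
    profileWeight δ u r ≤ Real.exp (-(4 * δ * N)⁻¹ * r ^ 2) := by
  rw [← profileWeight_const]
  exact profileWeight_mono hδ hm hu (.const_right hu.left_le_right) hu.ge r

lemma IsBetween.le_weight (hδ : 0 < δ) (hm : 0 < m) (hu : IsBetween m N u) (r : ℝ) :
    Real.exp (-(4 * δ * m)⁻¹ * r ^ 2) ≤ profileWeight δ u r := by
  rw [← profileWeight_const]
  exact profileWeight_mono hδ hm (.const hu.left_le_right) hu hu.le r

lemma IsBetween.continuous_weight (hδ : 0 < δ) (hm : 0 < m) (hu : IsBetween m N u) :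
    Continuous (profileWeight δ u) :=
  Real.continuous_exp.comp
    (intervalIntegral.continuous_primitive (hu.intervalIntegrable hδ hm) 0).neg

lemma integrable_gaussian_weight (hδ : 0 < δ) (hN : 0 < N) :
    MeasureTheory.Integrable fun r : ℝ => Real.exp (-(4 * δ * N)⁻¹ * r ^ 2) :=
  integrable_exp_neg_mul_sq (by positivity)

lemma IsBetween.integrable_weight (hδ : 0 < δ) (hm : 0 < m) (hu : IsBetween m N u) :
    MeasureTheory.Integrable (profileWeight δ u) := by
  refine (integrable_gaussian_weight hδ (hm.trans_le hu.left_le_right)).mono'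
    (hu.continuous_weight hδ hm).aestronglyMeasurable (Eventually.of_forall fun r => ?_)
  rw [Real.norm_of_nonneg (profileWeight_pos r).le]
  exact hu.weight_le hδ hm r

lemma IsBetween.tendsto_setIntegral_weight (hδ : 0 < δ) (hm : 0 < m) {u : ℕ → ℝ → ℝ} {v : ℝ → ℝ}
    (hu : ∀ n, IsBetween m N (u n)) (hv : ∀ x, Tendsto (fun n => u n x) atTop (𝓝 (v x)))
    (S : Set ℝ) :
    Tendsto (fun n => ∫ r in S, profileWeight δ (u n) r) atTop
      (𝓝 (∫ r in S, profileWeight δ v r)) := by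
  have hN : 0 < N := hm.trans_le (hu 0).left_le_right
  refine MeasureTheory.tendsto_integral_of_dominated_convergence
    (fun r => Real.exp (-(4 * δ * N)⁻¹ * r ^ 2))
    (fun n => ((hu n).continuous_weight hδ hm).aestronglyMeasurable)
    (integrable_gaussian_weight hδ hN).integrableOn
    (fun n => Eventually.of_forall fun r => ?_) (Eventually.of_forall fun r => ?_)
  · rw [Real.norm_of_nonneg (profileWeight_pos r).le]
    exact (hu n).weight_le hδ hm r
  · refine (Real.continuous_exp.tendsto _).comp (Tendsto.neg ?_)
    refine intervalIntegral.tendsto_integral_filter_of_dominated_convergence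
      (fun s => |s| / (2 * δ * m)) (Eventually.of_forall fun n => ?_)
      (Eventually.of_forall fun n => Eventually.of_forall fun s _ => (hu n).abs_div_le hδ hm s)
      (Continuous.intervalIntegrable (by fun_prop) _ _) (Eventually.of_forall fun s _ => ?_)
    · exact (measurable_id.div ((hu n).measurable.const_mul _)).aestronglyMeasurable
    · have : 0 < v s := hm.trans_le (ge_of_tendsto' (hv s) fun n => (hu n).le s)
      exact tendsto_const_nhds.div ((hv s).const_mul _) (by positivity)

lemma IsBetween.of_tendsto {u : ℕ → ℝ → ℝ} {v : ℝ → ℝ} (hu : ∀ n, IsBetween m N (u n))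
    (hv : ∀ x, Tendsto (fun n => u n x) atTop (𝓝 (v x))) : IsBetween m N v :=
  ⟨measurable_of_tendsto_metrizable (fun n => (hu n).measurable) (tendsto_pi_nhds.2 hv),
    fun x => ge_of_tendsto' (hv x) fun n => (hu n).le x,
    fun x => le_of_tendsto' (hv x) fun n => (hu n).ge x⟩

end Weight

section FixedPoint

variable {δ m N q : ℝ} {u : ℝ → ℝ}

/-- A pointwise limit of fixed points, or of successive iterates, is a fixed point: the operator is
continuous under pointwise convergence. -/
lemma isFixedProfile_of_tendsto (hδ : 0 < δ) (hm : 0 < m) {q' : ℕ → ℝ} {u u' : ℕ → ℝ → ℝ}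
    {v : ℝ → ℝ} (hu : ∀ n, IsBetween m N (u n)) (hq : Tendsto q' atTop (𝓝 q))
    (hv : ∀ x, Tendsto (fun n => u n x) atTop (𝓝 (v x)))
    (hv' : ∀ x, Tendsto (fun n => u' n x) atTop (𝓝 (v x)))
    (hstep : ∀ n ξ, u' n ξ = √(m ^ 2 + q' n * ∫ r in Iic ξ, profileWeight δ (u n) r)) :
    IsFixedProfile δ m q v := fun ξ => by
  refine tendsto_nhds_unique (hv' ξ) ?_
  simp only [hstep]
  exact (Real.continuous_sqrt.tendsto _).comp
    ((hq.mul (IsBetween.tendsto_setIntegral_weight hδ hm hu hv (Iic ξ))).const_add _)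

lemma IsBetween.sqrt (hδ : 0 < δ) (hm : 0 < m) (hq : 0 ≤ q)
    (hN : m ^ 2 + q * ∫ r, Real.exp (-(4 * δ * N)⁻¹ * r ^ 2) ≤ N ^ 2) (hu : IsBetween m N u) :
    IsBetween m N fun ξ => √(m ^ 2 + q * ∫ r in Iic ξ, profileWeight δ u r) := by
  have hN0 : 0 < N := hm.trans_le hu.left_le_right
  have hi := hu.integrable_weight hδ hm
  have h0 : ∀ S : Set ℝ, 0 ≤ ∫ r in S, profileWeight δ u r := fun S =>
    MeasureTheory.integral_nonneg fun r => (profileWeight_pos r).le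
  refine ⟨Monotone.measurable fun x y hxy => Real.sqrt_le_sqrt ?_, fun ξ => ?_, fun ξ => ?_⟩
  · refine add_le_add_right (mul_le_mul_of_nonneg_left ?_ hq) _
    exact MeasureTheory.setIntegral_mono_set hi.integrableOn
      (Eventually.of_forall fun r => (profileWeight_pos r).le) (Iic_subset_Iic.2 hxy).eventuallyLE
  · refine Real.le_sqrt_of_sq_le ?_
    have := mul_nonneg hq (h0 (Iic ξ))
    linarith
  · refine (Real.sqrt_le_left hN0.le).2 (le_trans ?_ hN)
    refine add_le_add_right (mul_le_mul_of_nonneg_left ?_ hq) _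
    refine (MeasureTheory.setIntegral_le_integral hi
      (Eventually.of_forall fun r => (profileWeight_pos r).le)).trans ?_
    exact MeasureTheory.integral_mono hi (integrable_gaussian_weight hδ hN0)
      (hu.weight_le hδ hm)

lemma sqrt_integral_weight_mono (hδ : 0 < δ) (hm : 0 < m) {q' : ℝ} {v : ℝ → ℝ} (hq : 0 ≤ q)
    (hqq : q ≤ q') (hu : IsBetween m N u) (hv : IsBetween m N v) (huv : ∀ x, u x ≤ v x) (ξ : ℝ) :
    √(m ^ 2 + q * ∫ r in Iic ξ, profileWeight δ u r) ≤
      √(m ^ 2 + q' * ∫ r in Iic ξ, profileWeight δ v r) := by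
  refine Real.sqrt_le_sqrt (add_le_add_right (mul_le_mul hqq ?_ ?_ (hq.trans hqq)) _)
  · exact MeasureTheory.setIntegral_mono (hu.integrable_weight hδ hm).integrableOn
      (hv.integrable_weight hδ hm).integrableOn (profileWeight_mono hδ hm hu hv huv)
  · exact MeasureTheory.integral_nonneg fun r => (profileWeight_pos r).le

/-- The iteration starting from the constant `m` increases to a fixed point lying below every fixed
point for the same or a larger constant. -/
lemma exists_isFixedProfile_le (hδ : 0 < δ) (hm : 0 < m) (hmN : m ≤ N) (hq : 0 ≤ q)
    (hN : m ^ 2 + q * ∫ r, Real.exp (-(4 * δ * N)⁻¹ * r ^ 2) ≤ N ^ 2) :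
    ∃ u, IsBetween m N u ∧ IsFixedProfile δ m q u ∧ ∀ q' v, q ≤ q' → IsBetween m N v →
      IsFixedProfile δ m q' v → ∀ x, u x ≤ v x := by
  set Ψ : (ℝ → ℝ) → ℝ → ℝ := fun u ξ => √(m ^ 2 + q * ∫ r in Iic ξ, profileWeight δ u r) with hΨ
  set w : ℕ → ℝ → ℝ := fun n => Ψ^[n] fun _ => m with hw
  have hsucc : ∀ n, w (n + 1) = Ψ (w n) := fun n => Function.iterate_succ_apply' Ψ n _
  have hb : ∀ n, IsBetween m N (w n) := fun n => by
    induction n with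
    | zero => exact .const hmN
    | succ n ih => rw [hsucc]; exact ih.sqrt hδ hm hq hN
  have hstep : ∀ n x, w n x ≤ w (n + 1) x := fun n => by
    induction n with
    | zero => exact (hb 1).le
    | succ n ih =>
      intro x
      rw [hsucc n, hsucc (n + 1)]
      exact sqrt_integral_weight_mono hδ hm hq le_rfl (hb n) (hb (n + 1)) ih x
  have hlim : ∀ x, Tendsto (fun n => w n x) atTop (𝓝 (⨆ n, w n x)) := fun x =>
    tendsto_atTop_ciSup (monotone_nat_of_le_succ fun n => hstep n x)
      ⟨N, by rintro _ ⟨n, rfl⟩; exact (hb n).ge x⟩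
  refine ⟨fun x => ⨆ n, w n x, .of_tendsto hb hlim, ?_, fun q' v hqq hv hfix x => ?_⟩
  · exact isFixedProfile_of_tendsto (u' := fun n => w (n + 1)) hδ hm hb tendsto_const_nhds hlim
      (fun x => (hlim x).comp (tendsto_add_atTop_nat 1)) fun n ξ => by rw [hsucc]
  · refine ciSup_le fun n => ?_
    induction n generalizing x with
    | zero => exact hv.le x
    | succ n ih =>
      rw [hsucc, hfix x]
      exact sqrt_integral_weight_mono hδ hm hq hqq (hb n) hv ih x

end FixedPoint

/-! ### Regularity and uniqueness of fixed points -/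

section Regularity

variable {δ m N q : ℝ} {u : ℝ → ℝ}

namespace IsFixedProfile

lemma sq_eq (hq : 0 ≤ q) (h : IsFixedProfile δ m q u) (ξ : ℝ) :
    u ξ ^ 2 = m ^ 2 + q * ∫ r in Iic ξ, profileWeight δ u r := by
  rw [h ξ]
  refine Real.sq_sqrt (add_nonneg (sq_nonneg m) (mul_nonneg hq ?_))
  exact MeasureTheory.integral_nonneg fun r => (profileWeight_pos r).le

lemma hasDerivAt_sq (hδ : 0 < δ) (hm : 0 < m) (hq : 0 ≤ q) (hu : IsBetween m N u)
    (h : IsFixedProfile δ m q u) (ξ : ℝ) :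
    HasDerivAt (fun x => u x ^ 2) (q * profileWeight δ u ξ) ξ := by
  have hi := hu.integrable_weight hδ hm
  have heq : (fun x => u x ^ 2) = fun x => (m ^ 2 + q * ∫ r in Iic (0 : ℝ), profileWeight δ u r) +
      q * ∫ r in (0 : ℝ)..x, profileWeight δ u r := funext fun x => by
    rw [h.sq_eq hq, ← intervalIntegral.integral_Iic_sub_Iic hi.integrableOn hi.integrableOn]
    ring
  rw [heq]
  exact (((hu.continuous_weight hδ hm).integral_hasStrictDerivAt 0 ξ).hasDerivAt.const_mul
    q).const_add _

lemma hasDerivAt (hδ : 0 < δ) (hm : 0 < m) (hq : 0 ≤ q) (hu : IsBetween m N u)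
    (h : IsFixedProfile δ m q u) (ξ : ℝ) :
    HasDerivAt u (q * profileWeight δ u ξ / (2 * u ξ)) ξ := by
  have hpos : ∀ x, 0 < u x := fun x => hm.trans_le (hu.le x)
  have h1 := (h.hasDerivAt_sq hδ hm hq hu ξ).sqrt (pow_pos (hpos ξ) 2).ne'
  simpa only [Real.sqrt_sq (hpos _).le] using h1

lemma hasDerivAt_weight (hδ : 0 < δ) (hm : 0 < m) (hq : 0 ≤ q) (hu : IsBetween m N u)
    (h : IsFixedProfile δ m q u) (ξ : ℝ) :
    HasDerivAt (profileWeight δ u) (-(ξ / (2 * δ * u ξ)) * profileWeight δ u ξ) ξ := by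
  have hpos : ∀ x, 0 < u x := fun x => hm.trans_le (hu.le x)
  have hc : Continuous u := continuous_iff_continuousAt.2 fun x =>
    (h.hasDerivAt hδ hm hq hu x).continuousAt
  have hc' : Continuous fun s => s / (2 * δ * u s) :=
    continuous_id.div (by fun_prop) fun s => by have := hpos s; positivity
  exact ((hc'.integral_hasStrictDerivAt 0 ξ).hasDerivAt.fun_neg.exp).congr_deriv
    (by unfold profileWeight; ring)

/-- The profile equation `δ (u ^ 2)'' + ξ u' = 0` in integrated form. -/
lemma hasDerivAt_flux (hδ : 0 < δ) (hm : 0 < m) (hq : 0 ≤ q) (hu : IsBetween m N u)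
    (h : IsFixedProfile δ m q u) (ξ : ℝ) :
    HasDerivAt (fun x => δ * (q * profileWeight δ u x) + x * u x) (u ξ) ξ := by
  have hpos : 0 < u ξ := hm.trans_le (hu.le ξ)
  refine ((((h.hasDerivAt_weight hδ hm hq hu ξ).const_mul q).const_mul δ).fun_add
    ((hasDerivAt_id' ξ).fun_mul (h.hasDerivAt hδ hm hq hu ξ))).congr_deriv ?_
  field_simp
  ring

lemma tendsto_weight_atBot (hδ : 0 < δ) (hm : 0 < m) (hu : IsBetween m N u) :
    Tendsto (profileWeight δ u) atBot (𝓝 0) := by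
  have hN : 0 < N := hm.trans_le hu.left_le_right
  refine squeeze_zero (fun r => (profileWeight_pos r).le) (hu.weight_le hδ hm) ?_
  refine Real.tendsto_exp_atBot.comp (Tendsto.const_mul_atTop_of_neg ?_ ?_)
  · exact neg_neg_of_pos (by positivity)
  · exact (tendsto_congr fun x : ℝ => sq_abs x).1 <| (tendsto_pow_atTop two_ne_zero).comp tendsto_abs_atBot_atTop

lemma tendsto_mul_sub_atBot (hδ : 0 < δ) (hm : 0 < m) (hq : 0 ≤ q) (hu : IsBetween m N u)
    (h : IsFixedProfile δ m q u) : Tendsto (fun ξ => ξ * (u ξ - m)) atBot (𝓝 0) := by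
  have hN : 0 < N := hm.trans_le hu.left_le_right
  have hi := hu.integrable_weight hδ hm
  have hg : MeasureTheory.Integrable fun r : ℝ => |r * Real.exp (-(4 * δ * N)⁻¹ * r ^ 2)| :=
    (integrable_mul_exp_neg_mul_sq (by positivity)).abs
  have hlim : Tendsto (fun ξ : ℝ => q / (2 * m) *
      ∫ r in Iic ξ, |r * Real.exp (-(4 * δ * N)⁻¹ * r ^ 2)|) atBot (𝓝 0) := by
    have := (MeasureTheory.tendsto_integral_Iic_zero (μ := MeasureTheory.volume)
      (f := fun r : ℝ => |r * Real.exp (-(4 * δ * N)⁻¹ * r ^ 2)|) tendsto_id).const_mul (q / (2 * m))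
    simpa using this
  refine squeeze_zero_norm' ?_ hlim
  filter_upwards [eventually_le_atBot 0] with ξ hξ
  have h1 : u ξ - m ≤ q / (2 * m) * ∫ r in Iic ξ, profileWeight δ u r := by
    rw [div_mul_eq_mul_div, le_div_iff₀ (by positivity)]
    have := h.sq_eq hq ξ
    nlinarith [hu.le ξ]
  have h2 : -ξ * ∫ r in Iic ξ, profileWeight δ u r ≤
      ∫ r in Iic ξ, |r * Real.exp (-(4 * δ * N)⁻¹ * r ^ 2)| := by
    rw [← MeasureTheory.integral_const_mul]
    refine MeasureTheory.setIntegral_mono_on (hi.const_mul _).integrableOn hg.integrableOn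
      measurableSet_Iic fun r hr => ?_
    rw [abs_mul, abs_of_pos (Real.exp_pos _)]
    refine mul_le_mul ?_ (hu.weight_le hδ hm r) (profileWeight_pos r).le (abs_nonneg r)
    exact (neg_le_neg hr).trans (neg_le_abs r)
  rw [norm_mul, Real.norm_of_nonpos hξ, Real.norm_of_nonneg (sub_nonneg.2 (hu.le ξ))]
  calc -ξ * (u ξ - m) ≤ -ξ * (q / (2 * m) * ∫ r in Iic ξ, profileWeight δ u r) :=
        mul_le_mul_of_nonneg_left h1 (neg_nonneg.2 hξ)
    _ = q / (2 * m) * (-ξ * ∫ r in Iic ξ, profileWeight δ u r) := by ring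
    _ ≤ _ := mul_le_mul_of_nonneg_left h2 (by positivity)

/-- Ordered fixed points for the same constant agree on the left half-line: the difference of the
two integrated equations is monotone and vanishes at both ends. -/
lemma eq_of_le_of_nonpos (hδ : 0 < δ) (hm : 0 < m) (hq : 0 ≤ q) {v : ℝ → ℝ}
    (hu : IsBetween m N u) (hv : IsBetween m N v) (h : IsFixedProfile δ m q u)
    (h' : IsFixedProfile δ m q v) (huv : ∀ x, u x ≤ v x) {ξ : ℝ} (hξ : ξ ≤ 0) : u ξ = v ξ := by
  set H : ℝ → ℝ := fun x => (δ * (q * profileWeight δ v x) + x * v x) -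
    (δ * (q * profileWeight δ u x) + x * u x) with hH
  have hder : ∀ x, HasDerivAt H (v x - u x) x := fun x =>
    (h'.hasDerivAt_flux hδ hm hq hv x).fun_sub (h.hasDerivAt_flux hδ hm hq hu x)
  have hmono : Monotone H := monotone_of_deriv_nonneg (fun x => (hder x).differentiableAt)
    fun x => by rw [(hder x).deriv]; exact sub_nonneg.2 (huv x)
  have hlim : Tendsto H atBot (𝓝 0) := by
    have h1 := ((((tendsto_weight_atBot hδ hm hv).const_mul q).const_mul δ).add
      (h'.tendsto_mul_sub_atBot hδ hm hq hv)).sub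
      ((((tendsto_weight_atBot hδ hm hu).const_mul q).const_mul δ).add
      (h.tendsto_mul_sub_atBot hδ hm hq hu))
    simp only [mul_zero, add_zero, sub_zero] at h1
    refine h1.congr fun x => ?_
    simp only [hH]; ring
  have hzero : ∀ x ≤ 0, H x = 0 := fun x hx => by
    refine le_antisymm ((hmono hx).trans ?_) (hmono.le_of_tendsto hlim x)
    simp [hH, profileWeight_zero]
  have h1 : HasDerivWithinAt H 0 (Iic ξ) ξ :=
    (hasDerivWithinAt_const ξ (Iic ξ) (0 : ℝ)).congr (fun x hx => hzero x (le_trans hx hξ))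
      (hzero ξ hξ)
  have := (uniqueDiffOn_Iic ξ ξ self_mem_Iic).eq_deriv _ (hder ξ).hasDerivWithinAt h1
  linarith

/-- Fixed points with the same constant and the same value at the origin agree on the right
half-line: Gronwall's inequality for the pair formed by `v ^ 2 - u ^ 2` and the difference of the
integrated equations. -/
lemma eq_of_nonneg (hδ : 0 < δ) (hm : 0 < m) (hq : 0 ≤ q) {v : ℝ → ℝ}
    (hu : IsBetween m N u) (hv : IsBetween m N v) (h : IsFixedProfile δ m q u)
    (h' : IsFixedProfile δ m q v) (h0 : u 0 = v 0) {R : ℝ} (hR : 0 ≤ R) : u R = v R := by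
  set H : ℝ → ℝ := fun x => (δ * (q * profileWeight δ v x) + x * v x) -
    (δ * (q * profileWeight δ u x) + x * u x) with hH
  set D : ℝ → ℝ := fun x => v x ^ 2 - u x ^ 2 with hD
  have hderH : ∀ x, HasDerivAt H (v x - u x) x := fun x =>
    (h'.hasDerivAt_flux hδ hm hq hv x).fun_sub (h.hasDerivAt_flux hδ hm hq hu x)
  have hderD : ∀ x, HasDerivAt D ((H x - x * (v x - u x)) / δ) x := fun x =>
    ((h'.hasDerivAt_sq hδ hm hq hv x).fun_sub (h.hasDerivAt_sq hδ hm hq hu x)).congr_deriv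
      (by simp only [hH]; field_simp; ring)
  have hder : ∀ x, HasDerivAt (fun y => (D y, H y))
      ((H x - x * (v x - u x)) / δ, v x - u x) x := fun x => (hderD x).prodMk (hderH x)
  have hdiff : ∀ x, |v x - u x| ≤ |D x| / (2 * m) := fun x => by
    have e : D x = (v x - u x) * (v x + u x) := by simp only [hD]; ring
    have hs : 2 * m ≤ v x + u x := by linarith [hu.le x, hv.le x]
    rw [le_div_iff₀ (by positivity), e, abs_mul, abs_of_pos (by linarith : 0 < v x + u x)]
    exact mul_le_mul_of_nonneg_left hs (abs_nonneg _)
  have hgr := norm_le_gronwallBound_of_norm_deriv_right_le (f := fun y => (D y, H y))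
    (f' := fun x => ((H x - x * (v x - u x)) / δ, v x - u x)) (δ := 0)
    (K := (1 + R / (2 * m)) / δ + 1 / (2 * m)) (ε := 0) (a := 0) (b := R)
    (fun x _ => (hder x).continuousAt.continuousWithinAt)
    (fun x _ => (hder x).hasDerivWithinAt) (by simp [hH, hD, h0, profileWeight_zero])
    (fun x hx => by
      have n1 : |D x| ≤ ‖(D x, H x)‖ := norm_fst_le (D x, H x)
      have n2 : |H x| ≤ ‖(D x, H x)‖ := norm_snd_le (D x, H x)
      generalize ‖(D x, H x)‖ = n at n1 n2 ⊢
      have hn : 0 ≤ n := (abs_nonneg _).trans n1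
      have k1 : |v x - u x| ≤ n / (2 * m) := (hdiff x).trans (by gcongr)
      have k2 : |(H x - x * (v x - u x)) / δ| ≤ (n + R * (n / (2 * m))) / δ := by
        rw [abs_div, abs_of_pos hδ]
        refine div_le_div_of_nonneg_right ((abs_sub _ _).trans (add_le_add n2 ?_)) hδ.le
        rw [abs_mul, abs_of_nonneg hx.1]
        exact mul_le_mul hx.2.le k1 (abs_nonneg _) hR
      have p1 : 0 ≤ n / (2 * m) := by positivity
      have p2 : 0 ≤ (n + R * (n / (2 * m))) / δ := by positivity
      have e : ((1 + R / (2 * m)) / δ + 1 / (2 * m)) * n + 0 =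
        (n + R * (n / (2 * m))) / δ + n / (2 * m) := by ring
      rw [e]
      refine norm_prod_le_iff.2 ⟨?_, ?_⟩
      · exact k2.trans (by linarith)
      · exact k1.trans (by linarith))
    R ⟨hR, le_rfl⟩
  rw [gronwallBound_ε0_δ0] at hgr
  have hDR : |D R| ≤ 0 := (norm_fst_le (D R, H R)).trans hgr
  have := (hdiff R).trans (div_le_div_of_nonneg_right hDR (by positivity))
  rw [zero_div] at this
  linarith [abs_nonpos_iff.1 this]

theorem eq_of_le (hδ : 0 < δ) (hm : 0 < m) (hq : 0 ≤ q) {v : ℝ → ℝ}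
    (hu : IsBetween m N u) (hv : IsBetween m N v) (h : IsFixedProfile δ m q u)
    (h' : IsFixedProfile δ m q v) (huv : ∀ x, u x ≤ v x) : u = v := by
  funext x
  rcases le_total x 0 with hx | hx
  · exact h.eq_of_le_of_nonpos hδ hm hq hu hv h' huv hx
  · exact h.eq_of_nonneg hδ hm hq hu hv h'
      (h.eq_of_le_of_nonpos hδ hm hq hu hv h' huv le_rfl) hx

/-- A fixed point is a profile for `lam = 0`, with limits read off from the integral formula. -/
lemma isProfile (hδ : 0 < δ) (hm : 0 < m) (hq : 0 ≤ q) (hu : IsBetween m N u)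
    (h : IsFixedProfile δ m q u) {M : ℝ} (hM : 0 ≤ M)
    (hlim : m ^ 2 + q * ∫ r, profileWeight δ u r = M ^ 2) : IsProfile δ 0 m M u := by
  have hpos : ∀ x, 0 < u x := fun x => hm.trans_le (hu.le x)
  have hi := hu.integrable_weight hδ hm
  have hd : deriv u = fun ξ => q * profileWeight δ u ξ / (2 * u ξ) :=
    funext fun x => (h.hasDerivAt hδ hm hq hu x).deriv
  have hc : Continuous u := continuous_iff_continuousAt.2 fun x =>
    (h.hasDerivAt hδ hm hq hu x).continuousAt
  have hdd : ∀ x, HasDerivAt (deriv u) (((q * (-(x / (2 * δ * u x)) * profileWeight δ u x)) *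
      (2 * u x) - q * profileWeight δ u x * (2 * (q * profileWeight δ u x / (2 * u x)))) /
        (2 * u x) ^ 2) x := fun x => by
    rw [hd]
    exact ((h.hasDerivAt_weight hδ hm hq hu x).const_mul q).fun_div
      ((h.hasDerivAt hδ hm hq hu x).const_mul 2) (by have := hpos x; positivity)
  refine ⟨?_, hpos, fun ξ => ?_, ?_, ?_⟩
  · have hw := hu.continuous_weight hδ hm
    have h1 : ContDiff ℝ 1 (deriv u) := by
      refine contDiff_one_iff_deriv.2 ⟨fun x => (hdd x).differentiableAt, ?_⟩
      rw [show deriv (deriv u) = _ from funext fun x => (hdd x).deriv]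
      have e : Continuous fun x => x / (2 * δ * u x) :=
        continuous_id.div (by fun_prop) fun x => by have := hpos x; positivity
      have e' : Continuous fun x => q * profileWeight δ u x / (2 * u x) :=
        Continuous.div (by fun_prop) (by fun_prop) fun x => by have := hpos x; positivity
      exact Continuous.div (by fun_prop) (by fun_prop) fun x => by have := hpos x; positivity
    have e : ContDiff ℝ (1 + 1) u := contDiff_succ_iff_deriv.2
      ⟨fun x => (h.hasDerivAt hδ hm hq hu x).differentiableAt, by simp, h1⟩
    rwa [one_add_one_eq_two] at e
  · have := hpos ξ
    rw [(hdd ξ).deriv, hd]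
    field_simp
    ring
  · have h1 := ((MeasureTheory.tendsto_integral_Iic_zero (μ := MeasureTheory.volume)
      (f := profileWeight δ u) tendsto_id).const_mul q).const_add (m ^ 2)
    have h2 := (Real.continuous_sqrt.tendsto _).comp h1
    rw [mul_zero, add_zero, Real.sqrt_sq hm.le] at h2
    exact h2.congr fun ξ => (h ξ).symm
  · have h1 := (((MeasureTheory.aecover_Iic tendsto_id).integral_tendsto_of_countably_generated
      hi).const_mul q).const_add (m ^ 2)
    have h2 := (Real.continuous_sqrt.tendsto _).comp h1
    rw [hlim, Real.sqrt_sq hM] at h2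
    exact h2.congr fun ξ => (h ξ).symm

end IsFixedProfile

end Regularity

/-! ### Existence of the profile and its inflection point -/

/-- Shooting in the constant `q`: the least fixed points depend monotonically and, being unique,
continuously on `q`, and so does their limit at `+∞`. -/
lemma exists_isFixedProfile_limit {δ m M : ℝ} (hδ : 0 < δ) (hm : 0 < m) (hmM : m < M) :
    ∃ q N u, 0 ≤ q ∧ IsBetween m N u ∧ IsFixedProfile δ m q u ∧
      m ^ 2 + q * ∫ r, profileWeight δ u r = M ^ 2 := by
  set c : ℝ := ∫ r : ℝ, Real.exp (-(4 * δ * m)⁻¹ * r ^ 2) with hc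
  have hc0 : 0 < c := by rw [hc, integral_gaussian]; positivity
  -- With `q = Q` even the smallest weight, that of `u = m`, brings `u ^ 2` up to `M ^ 2`.
  set Q : ℝ := (M ^ 2 - m ^ 2) / c with hQ
  have hQ0 : 0 ≤ Q := div_nonneg (by nlinarith) hc0.le
  set k : ℝ := √(Real.pi * (4 * δ)) with hk
  set N : ℝ := m + 1 + m ^ 2 + Q * k with hN
  have hQk : 0 ≤ Q * k := mul_nonneg hQ0 (Real.sqrt_nonneg _)
  have hN1 : 1 ≤ N := by nlinarith [sq_nonneg m]
  have hmN : m ≤ N := by nlinarith [sq_nonneg m]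
  have hNq : ∀ q ∈ Icc 0 Q,
      m ^ 2 + q * ∫ r, Real.exp (-(4 * δ * N)⁻¹ * r ^ 2) ≤ N ^ 2 := fun q hq => by
    rw [integral_gaussian, div_inv_eq_mul, ← mul_assoc, Real.sqrt_mul (by positivity)]
    have h1 : √N ≤ N := (Real.sqrt_le_left (by linarith)).2 (by nlinarith)
    have h2 : q * (k * √N) ≤ Q * (k * N) :=
      mul_le_mul hq.2 (mul_le_mul_of_nonneg_left h1 (Real.sqrt_nonneg _)) (by positivity) hQ0
    have h3 : m ^ 2 ≤ m ^ 2 * N := le_mul_of_one_le_right (sq_nonneg m) hN1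
    have h4 : (m ^ 2 + Q * k) * N ≤ N * N :=
      mul_le_mul_of_nonneg_right (by linarith) (by linarith)
    nlinarith
  have hex := fun q (hq : q ∈ Icc 0 Q) =>
    exists_isFixedProfile_le hδ hm hmN hq.1 (hNq q hq)
  choose! U hU hfix hleast using hex
  have hmono : ∀ q ∈ Icc 0 Q, ∀ q' ∈ Icc 0 Q, q ≤ q' → ∀ x, U q x ≤ U q' x :=
    fun q hq q' hq' h x => hleast q hq q' _ h (hU q' hq') (hfix q' hq') x
  set B : ℝ → ℝ := fun q => m ^ 2 + q * ∫ r, profileWeight δ (U q) r with hB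
  have hlimit : ∀ (s : ℕ → ℝ) (q : ℝ), (∀ n, s n ∈ Icc 0 Q) → q ∈ Icc 0 Q →
      Tendsto s atTop (𝓝 q) → (Monotone s ∨ Antitone s) →
      Tendsto (fun n => B (s n)) atTop (𝓝 (B q)) := fun s q hs hq hsq hsm => by
    have hv : ∀ x, ∃ y, Tendsto (fun n => U (s n) x) atTop (𝓝 y) := fun x => by
      rcases hsm with h | h
      · exact ⟨_, tendsto_atTop_ciSup (fun i j hij => hmono _ (hs i) _ (hs j) (h hij) x)
          ⟨N, by rintro _ ⟨n, rfl⟩; exact (hU _ (hs n)).ge x⟩⟩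
      · exact ⟨_, tendsto_atTop_ciInf (fun i j hij => hmono _ (hs j) _ (hs i) (h hij) x)
          ⟨m, by rintro _ ⟨n, rfl⟩; exact (hU _ (hs n)).le x⟩⟩
    choose v hv using hv
    have hvb : IsBetween m N v := .of_tendsto (fun n => hU _ (hs n)) hv
    have hvf : IsFixedProfile δ m q v := isFixedProfile_of_tendsto hδ hm (fun n => hU _ (hs n))
      hsq hv hv fun n => hfix _ (hs n)
    have hUv : U q = v := (hfix q hq).eq_of_le hδ hm hq.1 (hU q hq) hvb hvf
      (hleast q hq q v le_rfl hvb hvf)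
    have h1 := IsBetween.tendsto_setIntegral_weight hδ hm (fun n => hU _ (hs n)) hv univ
    simp only [MeasureTheory.setIntegral_univ] at h1
    simp only [hB, hUv]
    exact (hsq.mul h1).const_add _
  have hBQ : M ^ 2 ≤ B Q := by
    have hQm : Q ∈ Icc 0 Q := ⟨hQ0, le_rfl⟩
    have h1 : c ≤ ∫ r, profileWeight δ (U Q) r :=
      MeasureTheory.integral_mono (integrable_gaussian_weight hδ hm)
        ((hU Q hQm).integrable_weight hδ hm) ((hU Q hQm).le_weight hδ hm)
    have h2 : Q * c = M ^ 2 - m ^ 2 := div_mul_cancel₀ _ hc0.ne'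
    have h3 := mul_le_mul_of_nonneg_left h1 hQ0
    simp only [hB]
    linarith
  set S : Set ℝ := {q | q ∈ Icc 0 Q ∧ B q ≤ M ^ 2} with hS
  have h0S : (0 : ℝ) ∈ S := ⟨⟨le_rfl, hQ0⟩, by simp only [hB]; nlinarith⟩
  have hSb : BddAbove S := ⟨Q, fun q hq => hq.1.2⟩
  have hsup : sSup S ∈ Icc 0 Q := ⟨le_csSup hSb h0S, csSup_le ⟨0, h0S⟩ fun q hq => hq.1.2⟩
  have hle : B (sSup S) ≤ M ^ 2 := by
    obtain ⟨s, hs, hst, hsS⟩ := exists_seq_tendsto_sSup ⟨0, h0S⟩ hSb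
    exact le_of_tendsto' (hlimit s _ (fun n => (hsS n).1) hsup hst (Or.inl hs)) fun n => (hsS n).2
  have hge : M ^ 2 ≤ B (sSup S) := by
    rcases hsup.2.eq_or_lt with h | h
    · rwa [h]
    obtain ⟨s, hs, hsI, hst⟩ := exists_seq_strictAnti_tendsto' h
    refine ge_of_tendsto' (hlimit s _ (fun n => ⟨hsup.1.trans (hsI n).1.le, (hsI n).2.le⟩) hsup
      hst (Or.inr hs.antitone)) fun n => ?_
    by_contra! hlt
    exact (hsI n).1.not_ge (le_csSup hSb
      ⟨⟨hsup.1.trans (hsI n).1.le, (hsI n).2.le⟩, hlt.le⟩)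
  exact ⟨sSup S, N, U (sSup S), hsup.1, hU _ hsup, hfix _ hsup, le_antisymm hle hge⟩

theorem exists_isProfile {δ εm εp : ℝ} (hδ : 0 < δ) (hεm : 0 < εm) (hε : εm < εp) :
    ∃ u, IsProfile δ 0 εm εp u ∧ ∀ ξ, 0 < deriv u ξ := by
  obtain ⟨q, N, u, hq, hu, h, hlim⟩ := exists_isFixedProfile_limit hδ hεm hε
  refine ⟨u, h.isProfile hδ hεm hq hu (hεm.trans hε).le hlim, fun ξ => ?_⟩
  have hq0 : 0 < q := by
    refine hq.lt_of_ne fun h0 => ?_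
    rw [← h0] at hlim
    nlinarith
  rw [(h.hasDerivAt hδ hεm hq hu ξ).deriv]
  have := hεm.trans_le (hu.le ξ)
  have := profileWeight_pos (δ := δ) (u := u) ξ
  positivity

/-- The function `2δ u u' + ξ u` of a profile with `lam = 0` has derivative `u > 0`. It takes both
signs, hence has exactly one zero `c`, and `u''` has the opposite sign. -/
lemma IsProfile.exists_inflection {δ εm εp : ℝ} {u : ℝ → ℝ} (hδ : 0 < δ)
    (hu : IsProfile δ 0 εm εp u) (hd : ∀ ξ, 0 < deriv u ξ) :
    ∃ c, (∀ ξ < c, 0 < deriv (deriv u) ξ) ∧ ∀ ξ > c, deriv (deriv u) ξ < 0 := by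
  set h : ℝ → ℝ := fun ξ => 2 * δ * deriv u ξ + ξ with hh
  set F : ℝ → ℝ := fun ξ => u ξ * h ξ with hF
  have hder : ∀ ξ, HasDerivAt F (u ξ) ξ := fun ξ => by
    refine ((hu.hasDerivAt ξ).fun_mul (((hu.hasDerivAt_deriv ξ).const_mul (2 * δ)).fun_add
      (hasDerivAt_id' ξ))).congr_deriv ?_
    linear_combination hu.ode ξ
  have hmono : StrictMono F := strictMono_of_deriv_pos fun ξ => by
    rw [(hder ξ).deriv]; exact hu.pos ξ
  have hsecond : ∀ ξ, 2 * δ * u ξ ^ 2 * deriv (deriv u) ξ = -(deriv u ξ * F ξ) := fun ξ => by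
    simp only [hF, hh]; linear_combination u ξ * hu.ode ξ
  have hF0 : 0 ≤ F 0 := by
    have := hd 0; have := hu.pos 0
    simp only [hF, hh]; positivity
  have hneg : ∃ ξ, ξ ≤ 0 ∧ F ξ < 0 := by
    by_contra! hcon
    -- Otherwise `2δ u' ≥ -ξ` on the left half-line, and `2δ u + ξ² / 2` would be monotone there.
    have hmon : MonotoneOn (fun ξ => 2 * δ * u ξ + ξ ^ 2 / 2) (Iic 0) := by
      have hg : ∀ ξ, HasDerivAt (fun ξ => 2 * δ * u ξ + ξ ^ 2 / 2) (h ξ) ξ := fun ξ =>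
        (((hu.hasDerivAt ξ).const_mul (2 * δ)).fun_add
          (((hasDerivAt_id' ξ).fun_pow 2).div_const 2)).congr_deriv (by simp [hh])
      refine monotoneOn_of_deriv_nonneg (convex_Iic 0)
        (fun ξ _ => (hg ξ).continuousAt.continuousWithinAt)
        (fun ξ _ => (hg ξ).differentiableAt.differentiableWithinAt) fun ξ hξ => ?_
      rw [(hg ξ).deriv]
      exact nonneg_of_mul_nonneg_right (hcon ξ (show ξ ∈ Iic 0 from interior_subset hξ)) (hu.pos ξ)
    have hlarge := hmon (show -(1 + 2 * (2 * δ * u 0)) ∈ Iic (0 : ℝ) by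
      have := hu.pos 0
      simp only [mem_Iic, Left.neg_nonpos_iff]; positivity) self_mem_Iic (by
      have := hu.pos 0
      simp only [Left.neg_nonpos_iff]; positivity)
    have h1 := mul_pos (mul_pos two_pos hδ) (hu.pos (-(1 + 2 * (2 * δ * u 0))))
    have h2 := mul_pos (mul_pos two_pos hδ) (hu.pos 0)
    simp only at hlarge
    nlinarith
  obtain ⟨b, hb0, hb⟩ := hneg
  have hFc : Continuous F := continuous_iff_continuousAt.2 fun x => (hder x).continuousAt
  obtain ⟨c, -, hc⟩ := intermediate_value_Icc hb0 hFc.continuousOn ⟨hb.le, hF0⟩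
  refine ⟨c, fun ξ hξ => ?_, fun ξ hξ => ?_⟩
  · have h1 := hmono hξ
    have h2 : 0 < 2 * δ * u ξ ^ 2 := by have := hu.pos ξ; positivity
    have h3 := hsecond ξ
    have h4 := mul_pos (hd ξ) (neg_pos.2 (hc ▸ h1))
    by_contra! hcon
    nlinarith [mul_nonneg h2.le (neg_nonneg.2 hcon)]
  · have h1 := hmono hξ
    have h2 : 0 < 2 * δ * u ξ ^ 2 := by have := hu.pos ξ; positivity
    have h3 := hsecond ξ
    have h4 := mul_pos (hd ξ) (hc ▸ h1)
    by_contra! hcon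
    nlinarith [mul_nonneg h2.le hcon]

/-- A point where convexity changes to concavity is the point where the second derivative changes
sign. -/
lemma convexOn_concaveOn_iff_eq {u : ℝ → ℝ} (hu : ContDiff ℝ 2 u) {c : ℝ}
    (hpos : ∀ ξ < c, 0 < deriv (deriv u) ξ) (hneg : ∀ ξ > c, deriv (deriv u) ξ < 0) (a : ℝ) :
    (ConvexOn ℝ (Iio a) u ∧ ConcaveOn ℝ (Ioi a) u) ↔ a = c := by
  have hcvx : StrictConvexOn ℝ (Iio c) u := strictConvexOn_of_deriv2_pos (convex_Iio c)
    hu.continuous.continuousOn fun ξ hξ => hpos ξ (show ξ ∈ Iio c from interior_subset hξ)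
  have hccv : StrictConcaveOn ℝ (Ioi c) u := strictConcaveOn_of_deriv2_neg (convex_Ioi c)
    hu.continuous.continuousOn fun ξ hξ => hneg ξ (show ξ ∈ Ioi c from interior_subset hξ)
  -- No function is both convex and strictly concave on a nontrivial interval.
  have key : ∀ {v : ℝ → ℝ} {s t : Set ℝ} {x y : ℝ}, x < y → x ∈ s → y ∈ s → x ∈ t → y ∈ t →
      ConvexOn ℝ s v → StrictConcaveOn ℝ t v → False := by
    intro v s t x y hxy hxs hys hxt hyt h1 h2
    have e1 := h1.2 hxs hys (by norm_num : (0 : ℝ) ≤ 1 / 2) (by norm_num : (0 : ℝ) ≤ 1 / 2)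
      (by norm_num)
    have e2 := h2.2 hxt hyt hxy.ne (by norm_num : (0 : ℝ) < 1 / 2) (by norm_num : (0 : ℝ) < 1 / 2)
      (by norm_num)
    linarith
  refine ⟨fun ⟨h1, h2⟩ => ?_, fun h => h ▸ ⟨hcvx.convexOn, hccv.concaveOn⟩⟩
  rcases lt_trichotomy a c with h | h | h
  · obtain ⟨x, hax, hxc⟩ := exists_between h
    obtain ⟨y, hxy, hyc⟩ := exists_between hxc
    exact (key hxy hax (hax.trans hxy) hxc hyc h2.neg hcvx.neg).elim
  · exact h
  · obtain ⟨x, hcx, hxa⟩ := exists_between h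
    obtain ⟨y, hxy, hya⟩ := exists_between hxa
    exact (key hxy hxa hya hcx (hcx.trans hxy) h1 hccv).elim

theorem lemma1 (δ εm εp : ℝ) (hδ : 0 < δ) (hεm : 0 < εm) (hε : εm < εp) :
    (∀ lam : ℝ, ∃! u : ℝ → ℝ, IsProfile δ lam εm εp u) ∧
    (∀ (lam : ℝ) (u : ℝ → ℝ), IsProfile δ lam εm εp u →
      StrictMono u ∧
      ∀ T : ℝ, 0 < T →
        IsPMESolution δ εm εp T (selfSimilar lam u) ∧
        ∀ w : ℝ → ℝ → ℝ, IsPMESolution δ εm εp T w →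
          ∀ z : ℝ, ∀ θ ∈ Ioo 0 T, w z θ = selfSimilar lam u z θ) ∧
    (∃! lam : ℝ, ∃ u : ℝ → ℝ, IsProfile δ lam εm εp u ∧
      ConvexOn ℝ (Iio 0) u ∧ ConcaveOn ℝ (Ioi 0) u) := by
  obtain ⟨U, hU, hd⟩ := exists_isProfile hδ hεm hε
  have hprof : ∀ lam, IsProfile δ lam εm εp fun ξ => U (ξ + lam) := fun lam => by
    simpa using hU.comp_add lam
  have heq : ∀ {lam u}, IsProfile δ lam εm εp u → u = fun ξ => U (ξ + lam) := fun {lam u} hu =>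
    hu.unique hδ (hprof lam)
  refine ⟨fun lam => ⟨_, hprof lam, fun u hu => heq hu⟩, fun lam u hu => ⟨?_, fun T _ =>
    ⟨hu.isPMESolution_selfSimilar T, fun w hw z θ hθ =>
      hw.unique hδ (hu.isPMESolution_selfSimilar T) z hθ⟩⟩, ?_⟩
  · rw [heq hu]
    exact fun x y hxy => strictMono_of_deriv_pos hd (add_lt_add_left hxy lam)
  · obtain ⟨c, hpos, hneg⟩ := hU.exists_inflection hδ hd
    -- The profile for `lam` has its inflection point at `c - lam`.
    have hiff : ∀ lam, (ConvexOn ℝ (Iio 0) (fun ξ => U (ξ + lam)) ∧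
        ConcaveOn ℝ (Ioi 0) fun ξ => U (ξ + lam)) ↔ 0 = c - lam := fun lam => by
      have h1 : deriv (deriv fun ξ => U (ξ + lam)) = fun ξ => deriv (deriv U) (ξ + lam) := by
        rw [show deriv (fun ξ => U (ξ + lam)) = fun ξ => deriv U (ξ + lam) from
          funext fun ξ => deriv_comp_add_const U lam ξ]
        exact funext fun ξ => deriv_comp_add_const (deriv U) lam ξ
      refine convexOn_concaveOn_iff_eq (hprof lam).contDiff (fun ξ hξ => ?_) (fun ξ hξ => ?_) 0
      · rw [h1]; exact hpos _ (by linarith)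
      · rw [h1]; exact hneg _ (by linarith [show ξ > c - lam from hξ])
    refine ⟨c, ⟨_, hprof c, (hiff c).2 (sub_self c).symm⟩, fun lam ⟨u, hu, hcc⟩ => ?_⟩
    rw [heq hu] at hcc
    linarith [(hiff lam).1 hcc]
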